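/- Let $0<s<1$ and $\gamma\ge 0$. Write $\langle y\rangle=(1+|y|^2)^{1/2}$, let $\mathbb T^3=(\mathbb R/2\pi\mathbb Z)^3$ and let $L^p_{x,v}=L^p(\mathbb T^3\times\mathbb R^3)$. For $r\ge0$ let $\langle D_x\rangle^r$ and $\langle D_v\rangle^r$ be the Fourier multipliers in $x$ and in $v$ with symbols $\langle k\rangle^r$, $k\in\mathbb Z^3$, and $\langle\eta\rangle^r$, $\eta\in\mathbb R^3$ (for the Fourier transforms with kernels $e^{-ik\cdot x}$ and $e^{-iv\cdot\eta}$). Let $$\Delta_{\mathbb S^2}=\sum_{1\le j,k\le 3,\ j\ne k}(v_j\partial_{v_k}-v_k\partial_{v_j})^2,$$ let $(-\Delta_{\mathbb S^2})^{s/2}$ be the fractional power of the nonnegative self-adjoint operator $-\Delta_{\mathbb S^2}$ on $L^2(\mathbb R^3_v)$, and set $$|||h|||^2_{L^2_x}=\big\|\langle D_v\rangle^{s}\langle v\rangle^{\gamma/2}h\big\|^2_{L^2_{x,v}}+\big\|(-\Delta_{\mathbb S^2})^{s/2}\langle v\rangle^{\gamma/2}h\big\|^2_{L^2_{x,v}}.$$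 Then there is a constant $C>0$, depending only on $s$ and $\gamma$, such that for every $\varepsilon>0$ and every measurable $h:\mathbb T^3\times\mathbb R^3\to\mathbb C$, $$\big\|\langle v\rangle^{s+\frac\gamma2}h\big\|^2_{L^2_{x,v}}\le \varepsilon\Big(\big\|\langle v\rangle^{\frac{\gamma}{2(1+2s)}}\langle D_x\rangle^{\frac{s}{1+2s}}h\big\|^2_{L^2_{x,v}}+|||h|||^2_{L^2_x}\Big)+C\,\varepsilon^{-\frac{3+6s}{s}}\big\|\langle v\rangle^{3+7s+2\gamma}h\big\|^2_{L^1_{x,v}},$$ where a norm takes the value $+\infty$ when the function in it does not exist or does not belong to the space. -/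

import Mathlib

open MeasureTheory FourierTransform
open scoped ENNReal SchwartzMap

noncomputable section

namespace KineticLemma

/-- The velocity space `ℝ³` with its Euclidean norm. -/
abbrev E3 : Type := EuclideanSpace ℝ (Fin 3)

instance factTwoPiPos : Fact ((0 : ℝ) < 2 * Real.pi) := ⟨Real.two_pi_pos⟩

/-- The torus `𝕋³ = (ℝ / 2πℤ)³`, with Lebesgue measure (total mass `(2π)³`). -/
abbrev T3 : Type := Fin 3 → AddCircle (2 * Real.pi)

/-- `⟨v⟩^a = (1 + |v|²)^{a/2}`. -/
def bracketPow (a : ℝ) (v : E3) : ℝ := (1 + ‖v‖ ^ 2) ^ (a / 2)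

/-- The function `⟨v⟩^a h` of `(x, v)`. -/
def weight (a : ℝ) (h : T3 × E3 → ℂ) : T3 × E3 → ℂ :=
  fun p => (bracketPow a p.2 : ℂ) * h p

/-- The Fourier coefficient `∫_{𝕋³} e^{-i k·x} f(x) dx`, `k ∈ ℤ³`. -/
def torusFourier (f : T3 → ℂ) (k : Fin 3 → ℤ) : ℂ :=
  ∫ x : T3, (∏ j : Fin 3, fourier (-(k j)) (x j)) * f x

/-- For functions on the torus: `f` and `g` are in `L²` and `g = ⟨D_x⟩^r f`, where `⟨D_x⟩^r` is
the Fourier multiplier with symbol `⟨k⟩^r`. -/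
def IsDxPow (r : ℝ) (f g : T3 → ℂ) : Prop :=
  MemLp f 2 volume ∧ MemLp g 2 volume ∧
    ∀ k : Fin 3 → ℤ,
      torusFourier g k = (((1 + ∑ j, (k j : ℝ) ^ 2) ^ (r / 2) : ℝ) : ℂ) * torusFourier f k

/-- For functions on `ℝ³`: `f` and `g` are in `L²` and `g = ⟨D_v⟩^r f`, where `⟨D_v⟩^r` is the
Fourier multiplier with symbol `⟨η⟩^r` for the Fourier transform with kernel `e^{-i v·η}`. Since
`𝓕` is the (Plancherel) Fourier transform with kernel `e^{-2πi v·ξ}`, one has `η = 2πξ`. -/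
def IsDvPow (r : ℝ) (f g : E3 → ℂ) : Prop :=
  ∃ (hf : MemLp f 2 (volume : Measure E3)) (hg : MemLp g 2 (volume : Measure E3)),
    ∀ᵐ ξ : E3, (𝓕 (hg.toLp g) : Lp ℂ 2 (volume : Measure E3)) ξ =
      (bracketPow r ((2 * Real.pi) • ξ) : ℂ) * (𝓕 (hf.toLp f) : Lp ℂ 2 (volume : Measure E3)) ξ

/-- The rotation vector field `v_j ∂_{v_k} - v_k ∂_{v_j}`. -/
def rotDeriv (j k : Fin 3) (φ : E3 → ℂ) : E3 → ℂ := fun v =>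
  (v j : ℂ) * fderiv ℝ φ v (EuclideanSpace.single k 1) -
    (v k : ℂ) * fderiv ℝ φ v (EuclideanSpace.single j 1)

/-- `Δ_{𝕊²} = ∑_{1 ≤ j, k ≤ 3, j ≠ k} (v_j ∂_{v_k} - v_k ∂_{v_j})²`. -/
def sphLaplacian (φ : E3 → ℂ) : E3 → ℂ := fun v =>
  ∑ j : Fin 3, ∑ k : Fin 3, if j ≠ k then rotDeriv j k (rotDeriv j k φ) v else 0

/-- For functions on `ℝ³`: `f` and `g` are in `L²` and `g = (-Δ_{𝕊²})^{s/2} f`, for `s > 0`.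
The nonnegative self-adjoint operator `-Δ_{𝕊²}` on `L²(ℝ³)` has pure point spectrum (spherical
harmonics times radial functions), and its Schwartz eigenfunctions are dense in each eigenspace.
So its power `s / 2` in the sense of the spectral theorem is the operator that multiplies the
pairing with each Schwartz eigenfunction, of eigenvalue `lam`, by `lam ^ (s / 2)`. -/
def IsSphPow (s : ℝ) (f g : E3 → ℂ) : Prop :=
  MemLp f 2 (volume : Measure E3) ∧ MemLp g 2 (volume : Measure E3) ∧
    ∀ (φ : 𝓢(E3, ℂ)) (lam : ℝ), (∀ v, -(sphLaplacian φ v) = (lam : ℂ) * φ v) →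
      ∫ v, g v * φ v = ((lam ^ (s / 2) : ℝ) : ℂ) * ∫ v, f v * φ v

/-- `‖⟨v⟩^a ⟨D_x⟩^r h‖_{L²_{x,v}}` for `r ≥ 0`: the norm of `⟨v⟩^a g` for the (almost everywhere
unique) function `g = ⟨D_x⟩^r h`, and `∞` if there is no such `g`. -/
def normDx (a r : ℝ) (h : T3 × E3 → ℂ) : ℝ≥0∞ :=
  ⨅ (g : T3 × E3 → ℂ) (_ : AEStronglyMeasurable g volume)
    (_ : ∀ᵐ v : E3, IsDxPow r (fun x => h (x, v)) (fun x => g (x, v))),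
    eLpNorm (weight a g) 2 volume

/-- `‖⟨D_v⟩^r h‖_{L²_{x,v}}` for `r ≥ 0`, with the value `∞` if `⟨D_v⟩^r h` does not exist. -/
def normDv (r : ℝ) (h : T3 × E3 → ℂ) : ℝ≥0∞ :=
  ⨅ (g : T3 × E3 → ℂ) (_ : AEStronglyMeasurable g volume)
    (_ : ∀ᵐ x : T3, IsDvPow r (fun v => h (x, v)) (fun v => g (x, v))),
    eLpNorm g 2 volume

/-- `‖(-Δ_{𝕊²})^{s/2} h‖_{L²_{x,v}}` for `s > 0`, with the value `∞` if `(-Δ_{𝕊²})^{s/2} h` does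
not exist. -/
def normSph (s : ℝ) (h : T3 × E3 → ℂ) : ℝ≥0∞ :=
  ⨅ (g : T3 × E3 → ℂ) (_ : AEStronglyMeasurable g volume)
    (_ : ∀ᵐ x : T3, IsSphPow s (fun v => h (x, v)) (fun v => g (x, v))),
    eLpNorm g 2 volume

/-- The square of the triple norm,
`‖⟨D_v⟩^s ⟨v⟩^{γ/2} h‖²_{L²_{x,v}} + ‖(-Δ_{𝕊²})^{s/2} ⟨v⟩^{γ/2} h‖²_{L²_{x,v}}`. -/
def tripleNormSq (s γ : ℝ) (h : T3 × E3 → ℂ) : ℝ≥0∞ :=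
  normDv s (weight (γ / 2) h) ^ 2 + normSph s (weight (γ / 2) h) ^ 2

end KineticLemma

end

noncomputable section

namespace KineticLemma

open Set

/-! The spherical term only helps and is discarded; what remains is Sobolev embedding plus
interpolation. Put r = s/(1+2s) and q = 6/(3-2r). The regularity of order r in x embeds into L^q on
the torus. The regularity of order s ≥ r in v is used only at order r, so that it gives the same q.
Hence two mixed norms are controlled, L²_v L^q_x and L²_x L^q_v, each with its own weight.

Minkowski and Hölder (`lintegral_mixed_interpolation`) place the geometric mean of the two weighted
functions in L^p(x,v), where 1/p = 1/4 + 1/(2q). Since p > 1 is below q but the target exponent is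
2, a further Hölder step between L^p and a heavily weighted L¹ reaches L² (`eLpNorm_weight_sq_le`).
The result has the form (K S)^θ M^(1-θ), where S is the sum of the two regularity terms, M is the
squared L¹ norm and θ = (3+6s)/(3+7s). Young's inequality splits it, and θ/(1-θ) = (3+6s)/s is the
power of 1/ε.

Both critical Sobolev inequalities come from one abstract statement,
`exists_sobolev_of_frequency_split`. At each height t, the frequencies are cut at the N for which
the low part is at most t/2 in sup norm; Chebyshev bounds the measure of {|f| > t} by the energy of
the high part, and integration in t with Tonelli gives the L^q bound. Only a volume count of order
N^d and Plancherel are needed, so the argument covers ℝ³ and the torus alike. -/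

/-! ### Critical Sobolev inequality from a frequency splitting -/

theorem lintegral_Ioo_rpow {a p : ℝ} (ha : 0 ≤ a) (hp : -1 < p) :
    ∫⁻ t in Ioo 0 a, ENNReal.ofReal (t ^ p) = ENNReal.ofReal (a ^ (p + 1) / (p + 1)) := by
  have hi : IntegrableOn (fun t : ℝ => t ^ p) (Ioo 0 a) :=
    ((intervalIntegrable_iff_integrableOn_Ioc_of_le ha).1
      (intervalIntegral.intervalIntegrable_rpow' hp)).mono_set Ioo_subset_Ioc_self
  rw [← ofReal_integral_eq_lintegral_ofReal hi, ← integral_Ioc_eq_integral_Ioo,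
    ← intervalIntegral.integral_of_le ha, integral_rpow (Or.inl hp),
    Real.zero_rpow (by linarith), sub_zero]
  filter_upwards [ae_restrict_mem measurableSet_Ioo] with t ht
  exact Real.rpow_nonneg ht.1.le _

theorem lintegral_Ioi_rpow {a p : ℝ} (ha : 0 < a) (hp : p < -1) :
    ∫⁻ t in Ioi a, ENNReal.ofReal (t ^ p) = ENNReal.ofReal (-a ^ (p + 1) / (p + 1)) := by
  rw [← ofReal_integral_eq_lintegral_ofReal (integrableOn_Ioi_rpow_of_lt hp ha),
    integral_Ioi_rpow_of_lt hp ha]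
  filter_upwards [ae_restrict_mem measurableSet_Ioi] with t ht
  exact Real.rpow_nonneg (ha.trans ht).le _

/-- Sublevel sets of volume `O(N^d)` carry at most `O(N^(d-2r))` of the weight `ρ^(-2r)`. -/
theorem exists_lintegral_sublevel_rpow_neg_le {K : Type*} [MeasurableSpace K] (ν : Measure K)
    {ρ : K → ℝ} (hρm : Measurable ρ) (hρ : ∀ k, 0 < ρ k) {d r K₀ : ℝ} (hr : 0 < r)
    (hrd : 2 * r < d) (hK₀ : 0 ≤ K₀)
    (hcount : ∀ N : ℝ, 0 < N → ν {k | ρ k ≤ N} ≤ ENNReal.ofReal (K₀ * N ^ d)) :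
    ∃ C : ℝ, 0 < C ∧ ∀ N : ℝ, 0 < N →
      ∫⁻ k in {k | ρ k ≤ N}, ENNReal.ofReal (ρ k ^ (-(2 * r))) ∂ν ≤
        ENNReal.ofReal (C * N ^ (d - 2 * r)) := by
  -- The two terms come from cutting the layer-cake integral at t = 1/N; the added 1 keeps C
  -- positive when K₀ = 0.
  refine ⟨2 * r * (K₀ / (2 * r) + K₀ / (d - 2 * r)) + 1, ?_, fun N hN => ?_⟩
  · have : 0 < d - 2 * r := by linarith
    positivity
  have hd : 0 < d - 2 * r := by linarith
  have h1 : ∀ k, ρ k ^ (-(2 * r)) = (ρ k)⁻¹ ^ (2 * r) := fun k => by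
    rw [Real.inv_rpow (hρ k).le, Real.rpow_neg (hρ k).le]
  simp_rw [h1]
  rw [lintegral_rpow_eq_lintegral_meas_lt_mul _
    (Filter.Eventually.of_forall fun k => (inv_pos.2 (hρ k)).le) hρm.inv.aemeasurable
    (by positivity)]
  set A := {k | ρ k ≤ N} with hA
  have hAm : MeasurableSet A := measurableSet_le hρm measurable_const
  -- Inside the sublevel set, {ρ < 1/t} is counted at level N or at level 1/t. The first is used for
  -- t ≤ 1/N, the second beyond, where 2r < d gives convergence at infinity.
  have hsub : ∀ t : ℝ, 0 < t → (ν.restrict A) {k | t < (ρ k)⁻¹} ≤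
      min (ENNReal.ofReal (K₀ * N ^ d)) (ENNReal.ofReal (K₀ * (t⁻¹) ^ d)) := by
    intro t ht
    refine le_min ?_ ?_
    · exact (measure_mono (subset_univ _)).trans (by
        rw [Measure.restrict_apply_univ]; exact hcount N hN)
    · refine (Measure.restrict_apply_le _ _).trans
        ((measure_mono fun k hk => ?_).trans (hcount t⁻¹ (inv_pos.2 ht)))
      simp only [mem_ofPred_eq] at hk ⊢
      exact (le_inv_comm₀ ht (hρ k)).1 hk.le
  have hsplit : (∫⁻ t in Ioi (0:ℝ), (ν.restrict A) {k | t < (ρ k)⁻¹} *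
      ENNReal.ofReal (t ^ (2 * r - 1))) ≤
      ENNReal.ofReal (K₀ * N ^ d) * ENNReal.ofReal ((N⁻¹) ^ (2 * r) / (2 * r)) +
      ENNReal.ofReal K₀ * ENNReal.ofReal ((N⁻¹) ^ (2 * r - d) / (d - 2 * r)) := by
    have hN' : 0 < N⁻¹ := inv_pos.2 hN
    have hu : Ioi (0:ℝ) = Ioc 0 N⁻¹ ∪ Ioi N⁻¹ := (Ioc_union_Ioi_eq_Ioi hN'.le).symm
    rw [hu]
    refine (lintegral_union_le _ _ _).trans (add_le_add ?_ ?_)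
    · rw [setLIntegral_congr Ioo_ae_eq_Ioc.symm]
      calc _ ≤ ∫⁻ t in Ioo 0 N⁻¹, ENNReal.ofReal (K₀ * N ^ d) *
              ENNReal.ofReal (t ^ (2 * r - 1)) := by
            refine setLIntegral_mono' measurableSet_Ioo fun t ht => ?_
            gcongr
            exact (hsub t ht.1).trans (min_le_left _ _)
        _ = _ := by
            rw [lintegral_const_mul' _ _ ENNReal.ofReal_ne_top,
              lintegral_Ioo_rpow hN'.le (by linarith), sub_add_cancel]
    · calc _ ≤ ∫⁻ t in Ioi N⁻¹, ENNReal.ofReal K₀ * ENNReal.ofReal (t ^ (2 * r - 1 - d)) := by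
            refine setLIntegral_mono' measurableSet_Ioi fun t ht => ?_
            have ht0 : 0 < t := hN'.trans ht
            refine (mul_le_mul_left ((hsub t ht0).trans (min_le_right _ _)) _).trans (le_of_eq ?_)
            rw [← ENNReal.ofReal_mul (by positivity), ← ENNReal.ofReal_mul hK₀,
              Real.rpow_sub ht0 (2 * r - 1) d, Real.inv_rpow ht0.le]
            congr 1; ring
        _ = _ := by
            rw [lintegral_const_mul' _ _ ENNReal.ofReal_ne_top,
              lintegral_Ioi_rpow hN' (by linarith)]
            congr 2
            rw [show 2 * r - 1 - d + 1 = 2 * r - d by ring, neg_div, ← div_neg, neg_sub]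
  refine (mul_le_mul_right hsplit _).trans ?_
  rw [← ENNReal.ofReal_mul (by positivity), ← ENNReal.ofReal_mul hK₀,
    ← ENNReal.ofReal_add (by positivity) (by positivity), ← ENNReal.ofReal_mul (by positivity)]
  refine ENNReal.ofReal_le_ofReal ?_
  have e1 : N ^ d * N⁻¹ ^ (2 * r) = N ^ (d - 2 * r) := by
    rw [Real.rpow_sub hN, Real.inv_rpow hN.le]; rfl
  have e2 : N⁻¹ ^ (2 * r - d) = N ^ (d - 2 * r) := by
    rw [Real.inv_rpow hN.le, ← Real.rpow_neg hN.le, neg_sub]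
  have : 2 * r * (K₀ * N ^ d * (N⁻¹ ^ (2 * r) / (2 * r)) +
      K₀ * (N⁻¹ ^ (2 * r - d) / (d - 2 * r))) =
      2 * r * (K₀ / (2 * r) + K₀ / (d - 2 * r)) * N ^ (d - 2 * r) := by
    rw [e2, ← e1]; ring
  rw [this, add_mul]
  have : 0 < N ^ (d - 2 * r) := by positivity
  linarith

/-- Cauchy–Schwarz applied to e^(1/2) = ρ^(-r) · ρ^r e^(1/2). With e = |f̂|², the left side
dominates the sup norm of the low-frequency part. -/
theorem lintegral_sublevel_sqrt_le {K : Type*} [MeasurableSpace K] (ν : Measure K)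
    {ρ : K → ℝ} (hρm : Measurable ρ) (hρ : ∀ k, 0 < ρ k) (r : ℝ) (A : Set K)
    {e : K → ℝ≥0∞} (he : AEMeasurable e ν) :
    ∫⁻ k in A, e k ^ (1 / 2 : ℝ) ∂ν ≤
      (∫⁻ k in A, ENNReal.ofReal (ρ k ^ (-(2 * r))) ∂ν) ^ (1 / 2 : ℝ) *
        (∫⁻ k, ENNReal.ofReal (ρ k ^ (2 * r)) * e k ∂ν) ^ (1 / 2 : ℝ) := by
  have hpq : (2 : ℝ).HolderConjugate 2 := Real.HolderConjugate.two_two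
  have hm1 : Measurable fun k => ENNReal.ofReal (ρ k ^ (-r)) := (hρm.pow_const _).ennreal_ofReal
  have hm2 : AEMeasurable (fun k => ENNReal.ofReal (ρ k ^ r) * e k ^ (1 / 2 : ℝ))
    (ν.restrict A) := ((hρm.pow_const _).ennreal_ofReal.aemeasurable.mul (he.pow_const _)).restrict
  have := ENNReal.lintegral_mul_le_Lp_mul_Lq (ν.restrict A) hpq hm1.aemeasurable hm2
  refine le_trans (le_of_eq ?_) (this.trans ?_)
  · refine lintegral_congr fun k => ?_
    simp only [Pi.mul_apply]
    rw [← mul_assoc, ← ENNReal.ofReal_mul (Real.rpow_nonneg (hρ k).le _),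
      ← Real.rpow_add (hρ k)]
    simp
  · refine mul_le_mul' (le_of_eq ?_) ?_
    · congr 1
      refine lintegral_congr fun k => ?_
      rw [ENNReal.ofReal_rpow_of_nonneg (Real.rpow_nonneg (hρ k).le _) zero_le_two,
        ← Real.rpow_mul (hρ k).le]
      congr 2; ring
    · refine ENNReal.rpow_le_rpow ?_ (by norm_num)
      refine (setLIntegral_le_lintegral _ _).trans (le_of_eq (lintegral_congr fun k => ?_))
      rw [ENNReal.mul_rpow_of_nonneg _ _ zero_le_two, ← ENNReal.rpow_mul,
        ENNReal.ofReal_rpow_of_nonneg (Real.rpow_nonneg (hρ k).le _) zero_le_two,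
        ← Real.rpow_mul (hρ k).le]
      norm_num [mul_comm]

/-- Chebyshev's inequality for a function split as a part bounded by `t / 2` and an `L²` part. -/
theorem meas_lt_norm_le_of_split {Ω : Type*} [MeasurableSpace Ω] {μ : Measure Ω} {f l : Ω → ℂ}
    (hf : AEStronglyMeasurable f μ) (hl : AEStronglyMeasurable l μ) {t : ℝ} (ht : 0 < t)
    (hlt : ∀ᵐ x ∂μ, ‖l x‖ₑ ≤ ENNReal.ofReal (t / 2)) :
    μ {x | t < ‖f x‖} ≤
      ENNReal.ofReal (4 * t ^ (-2 : ℝ)) * ∫⁻ x, ‖f x - l x‖ₑ ^ (2 : ℝ) ∂μ := by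
  have hc := mul_meas_ge_le_lintegral₀ (μ := μ)
    ((hf.sub hl).enorm.pow_const (2 : ℝ)) (ENNReal.ofReal ((t / 2) ^ (2 : ℝ)))
  have hsub : μ {x | t < ‖f x‖} ≤
      μ {x | ENNReal.ofReal ((t / 2) ^ (2 : ℝ)) ≤ ‖(f - l) x‖ₑ ^ (2 : ℝ)} := by
    refine measure_mono_ae ?_
    filter_upwards [hlt] with x hx (hfx : t < ‖f x‖)
    show ENNReal.ofReal ((t / 2) ^ (2 : ℝ)) ≤ ‖(f - l) x‖ₑ ^ (2 : ℝ)
    rw [← ENNReal.ofReal_rpow_of_nonneg (by positivity) zero_le_two]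
    refine ENNReal.rpow_le_rpow ?_ zero_le_two
    rw [← ofReal_norm]
    refine ENNReal.ofReal_le_ofReal ?_
    rw [← ofReal_norm, ENNReal.ofReal_le_ofReal_iff (by positivity)] at hx
    have := norm_sub_norm_le (f x) (l x)
    rw [Pi.sub_apply]
    linarith
  have hpos : (0 : ℝ) < (t / 2) ^ (2 : ℝ) := by positivity
  calc μ {x | t < ‖f x‖} ≤ _ := hsub
    _ = ENNReal.ofReal (4 * t ^ (-2 : ℝ)) * (ENNReal.ofReal ((t / 2) ^ (2 : ℝ)) *
        μ {x | ENNReal.ofReal ((t / 2) ^ (2 : ℝ)) ≤ ‖(f - l) x‖ₑ ^ (2 : ℝ)}) := by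
        rw [← mul_assoc, ← ENNReal.ofReal_mul (by positivity)]
        rw [show 4 * t ^ (-2 : ℝ) * (t / 2) ^ (2 : ℝ) = 1 by
          rw [Real.rpow_neg ht.le, Real.rpow_two, Real.rpow_two]; field_simp; norm_num]
        simp
    _ ≤ _ := mul_le_mul_right hc _

/-- The layer-cake step of the Sobolev inequality. -/
theorem lintegral_rpow_le_of_meas_lt_le {Ω K : Type*} [MeasurableSpace Ω] [MeasurableSpace K]
    {μ : Measure Ω} {ν : Measure K} [SFinite ν] {ρ : K → ℝ} (hρm : Measurable ρ)
    (hρ : ∀ k, 0 < ρ k) {σ q M : ℝ} (hq : 2 < q) (hM : 0 < M)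
    {f : Ω → ℂ} (hf : AEStronglyMeasurable f μ) {e : K → ℝ≥0∞} (he : AEMeasurable e ν)
    (h : ∀ t : ℝ, 0 < t → μ {x | t < ‖f x‖} ≤
      ENNReal.ofReal (4 * t ^ (-2 : ℝ)) * ∫⁻ k in {k | t < M * ρ k ^ σ}, e k ∂ν) :
    ∫⁻ x, ‖f x‖ₑ ^ q ∂μ ≤ ENNReal.ofReal (4 * q / (q - 2) * M ^ (q - 2)) *
      ∫⁻ k, ENNReal.ofReal (ρ k ^ (σ * (q - 2))) * e k ∂ν := by
  have hq0 : 0 < q := by linarith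
  have hq2 : 0 < q - 2 := by linarith
  have e1 : ∀ x, ‖f x‖ₑ ^ q = ENNReal.ofReal (‖f x‖ ^ q) := fun x => by
    rw [← ofReal_norm, ENNReal.ofReal_rpow_of_nonneg (norm_nonneg _) hq0.le]
  simp_rw [e1]
  rw [lintegral_rpow_eq_lintegral_meas_lt_mul μ
    (Filter.Eventually.of_forall fun x => norm_nonneg _) hf.norm.aemeasurable hq0]
  have hS : MeasurableSet {p : ℝ × K | p.1 < M * ρ p.2 ^ σ} :=
    measurableSet_lt measurable_fst (((hρm.comp measurable_snd).pow_const _).const_mul _)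
  have hA : ∀ t : ℝ, MeasurableSet {k | t < M * ρ k ^ σ} := fun t =>
    measurableSet_lt measurable_const ((hρm.pow_const _).const_mul _)
  -- The powers t^(q-1) and t^(-2) combine to t^(q-3). The region t < M ρ^σ is kept as a joint
  -- indicator so that Tonelli can swap the integrals; integrating in t first gives (M
  -- ρ^σ)^(q-2)/(q-2).
  set Φ : ℝ → K → ℝ≥0∞ := fun t k =>
    ENNReal.ofReal (4 * t ^ (q - 3)) * ({p : ℝ × K | p.1 < M * ρ p.2 ^ σ}.indicator
      (fun p => e p.2) (t, k)) with hΦ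
  have hΦm : AEMeasurable (Function.uncurry Φ) ((volume.restrict (Ioi 0)).prod ν) := by
    refine AEMeasurable.mul ?_ ?_
    · exact ((measurable_fst.pow_const _).const_mul _).ennreal_ofReal.aemeasurable
    · exact (he.comp_quasiMeasurePreserving Measure.quasiMeasurePreserving_snd).indicator hS
  have step : ∫⁻ t in Ioi (0:ℝ), μ {x | t < ‖f x‖} * ENNReal.ofReal (t ^ (q - 1)) ≤
      ∫⁻ t in Ioi (0:ℝ), ∫⁻ k, Φ t k ∂ν := by
    refine setLIntegral_mono' measurableSet_Ioi fun t ht => ?_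
    have ht : 0 < t := ht
    refine (mul_le_mul_left (h t ht) _).trans (le_of_eq ?_)
    rw [lintegral_const_mul' _ _ ENNReal.ofReal_ne_top, mul_right_comm,
      ← ENNReal.ofReal_mul (by positivity), ← lintegral_indicator (hA t)]
    congr 2
    rw [mul_assoc, ← Real.rpow_add ht]
    ring_nf
  refine (mul_le_mul_right step _).trans ?_
  rw [lintegral_lintegral_swap hΦm]
  have inner : ∀ k, ∫⁻ t in Ioi (0:ℝ), Φ t k =
      ENNReal.ofReal (4 * (M ^ (q - 2) / (q - 2))) *
        (ENNReal.ofReal (ρ k ^ (σ * (q - 2))) * e k) := by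
    intro k
    have hM' : 0 < M * ρ k ^ σ := mul_pos hM (Real.rpow_pos_of_pos (hρ k) _)
    have : ∀ t : ℝ, Φ t k = (Iio (M * ρ k ^ σ)).indicator
        (fun t => ENNReal.ofReal (4 * t ^ (q - 3)) * e k) t := by
      intro t
      by_cases h : t < M * ρ k ^ σ
      · simp [hΦ, indicator, h]
      · simp [hΦ, indicator, h]
    simp_rw [this]
    rw [lintegral_indicator measurableSet_Iio, Measure.restrict_restrict measurableSet_Iio,
      inter_comm, Ioi_inter_Iio]
    have hm : Measurable fun t : ℝ => ENNReal.ofReal (4 * t ^ (q - 3)) := by fun_prop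
    rw [lintegral_mul_const _ hm]
    simp_rw [ENNReal.ofReal_mul (show (0:ℝ) ≤ 4 by norm_num)]
    rw [lintegral_const_mul' _ _ ENNReal.ofReal_ne_top,
      lintegral_Ioo_rpow hM'.le (by linarith), ← mul_assoc,
      ← ENNReal.ofReal_mul (by norm_num), ← ENNReal.ofReal_mul (by norm_num),
      ← ENNReal.ofReal_mul (by positivity)]
    congr 2
    rw [show q - 3 + 1 = q - 2 by ring, Real.mul_rpow hM.le (Real.rpow_nonneg (hρ k).le _),
      ← Real.rpow_mul (hρ k).le]
    ring
  simp_rw [inner]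
  rw [lintegral_const_mul' _ _ ENNReal.ofReal_ne_top, ← mul_assoc,
    ← ENNReal.ofReal_mul hq0.le]
  refine mul_le_mul_left (le_of_eq ?_) _
  congr 1
  ring

/-- The critical Sobolev inequality, for a pair of a physical space `(Ω, μ)` and a frequency space
`(K, ν)` on which the functions split into low and high frequencies. -/
theorem exists_sobolev_of_frequency_split {Ω K : Type*} [MeasurableSpace Ω] [MeasurableSpace K]
    (μ : Measure Ω) (ν : Measure K) [SFinite ν]
    {ρ : K → ℝ} (hρm : Measurable ρ) (hρ : ∀ k, 0 < ρ k) {d r K₀ : ℝ} (hr : 0 < r)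
    (hrd : 2 * r < d) (hK₀ : 0 ≤ K₀)
    (hcount : ∀ N : ℝ, 0 < N → ν {k | ρ k ≤ N} ≤ ENNReal.ofReal (K₀ * N ^ d)) :
    ∃ C : ℝ, 0 < C ∧ ∀ (f : Ω → ℂ) (e : K → ℝ≥0∞), AEStronglyMeasurable f μ → AEMeasurable e ν →
      (∀ N : ℝ, 0 < N → ∃ l : Ω → ℂ, AEStronglyMeasurable l μ ∧
        (∀ᵐ x ∂μ, ‖l x‖ₑ ≤ ∫⁻ k in {k | ρ k ≤ N}, e k ^ (1 / 2 : ℝ) ∂ν) ∧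
        ∫⁻ x, ‖f x - l x‖ₑ ^ (2 : ℝ) ∂μ ≤ ∫⁻ k in {k | N < ρ k}, e k ∂ν) →
      ∫⁻ x, ‖f x‖ₑ ^ (2 * d / (d - 2 * r)) ∂μ ≤
        ENNReal.ofReal C *
          (∫⁻ k, ENNReal.ofReal (ρ k ^ (2 * r)) * e k ∂ν) ^ (d / (d - 2 * r)) := by
  obtain ⟨C₁, hC₁, hlow⟩ := exists_lintegral_sublevel_rpow_neg_le ν hρm hρ hr hrd hK₀ hcount
  have hdr : 0 < d - 2 * r := by linarith
  have hd : 0 < d := by linarith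
  set q := 2 * d / (d - 2 * r) with hq
  set σ := (d - 2 * r) / 2 with hσ
  have hσ0 : 0 < σ := by positivity
  have hq2' : q - 2 = 4 * r / (d - 2 * r) := by rw [hq]; field_simp; ring
  have hq2 : 2 < q := by
    have : 0 < 4 * r / (d - 2 * r) := by positivity
    linarith
  have hσq : σ * (q - 2) = 2 * r := by rw [hq2', hσ]; field_simp; ring
  have hdq : d / (d - 2 * r) = 1 + (q - 2) / 2 := by rw [hq2']; field_simp; ring
  refine ⟨4 * q / (q - 2) * (2 * C₁ ^ (1 / 2 : ℝ)) ^ (q - 2), ?_, fun f e hf he hsplit => ?_⟩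
  · have : 0 < q - 2 := by linarith
    positivity
  set E := ∫⁻ k, ENNReal.ofReal (ρ k ^ (2 * r)) * e k ∂ν with hE
  have hexp : 0 < d / (d - 2 * r) := by positivity
  by_cases hEtop : E = ∞
  · rw [hEtop, ENNReal.top_rpow_of_pos hexp, ENNReal.mul_top]
    · exact le_top
    · rw [Ne, ENNReal.ofReal_eq_zero, not_le]
      have : 0 < q - 2 := by linarith
      positivity
  -- The cutoff chosen below divides by a multiple of E^(1/2), so zero energy is separate: then e
  -- vanishes almost everywhere and a split at any level forces f = 0.
  by_cases hE0 : E = 0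
  · have hez : e =ᵐ[ν] 0 := by
      have h0 := (lintegral_eq_zero_iff'
        ((hρm.pow_const _).ennreal_ofReal.aemeasurable.mul he)).1 (hE ▸ hE0)
      filter_upwards [h0] with k hk
      have : ENNReal.ofReal (ρ k ^ (2 * r)) ≠ 0 := by
        rw [Ne, ENNReal.ofReal_eq_zero, not_le]
        exact Real.rpow_pos_of_pos (hρ k) _
      simpa [this] using hk
    obtain ⟨l, hlm, hl, hfl⟩ := hsplit 1 one_pos
    have hI1 : ∫⁻ k in {k | ρ k ≤ 1}, e k ^ (1 / 2 : ℝ) ∂ν = 0 := by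
      rw [lintegral_eq_zero_iff' (he.pow_const _).restrict]
      filter_upwards [ae_restrict_of_ae hez] with k hk
      simp [hk]
    have hI2 : ∫⁻ k in {k | 1 < ρ k}, e k ∂ν = 0 := by
      rw [lintegral_eq_zero_iff' he.restrict]
      exact ae_restrict_of_ae hez
    rw [hI1] at hl
    rw [hI2, nonpos_iff_eq_zero] at hfl
    replace hfl := (lintegral_eq_zero_iff' (f := fun x => ‖f x - l x‖ₑ ^ (2 : ℝ))
      ((hf.sub hlm).enorm.pow_const (2 : ℝ))).1 hfl
    have : ∫⁻ x, ‖f x‖ₑ ^ q ∂μ = 0 := by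
      rw [lintegral_eq_zero_iff' (hf.enorm.pow_const _)]
      filter_upwards [hl, hfl] with x h1 h2
      have h3 : l x = 0 := by simpa using h1
      have h4 : f x = 0 := by simpa [h3] using h2
      have : 0 < q := by linarith
      simp [h4, this]
    rw [this]
    exact zero_le
  set b := E.toReal ^ (1 / 2 : ℝ) with hb
  have hEpos : 0 < E.toReal := ENNReal.toReal_pos hE0 hEtop
  have hEb : E ^ (1 / 2 : ℝ) = ENNReal.ofReal b := by
    rw [hb, ← ENNReal.ofReal_rpow_of_nonneg hEpos.le (by norm_num), ENNReal.ofReal_toReal hEtop]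
  have hb0 : 0 < b := by positivity
  -- The low part is at most C₁^(1/2) N^σ b. With this M and N^σ = t/M, that bound is exactly t/2,
  -- and the high frequencies ρ > N are those with M ρ^σ > t.
  set M := 2 * C₁ ^ (1 / 2 : ℝ) * b with hM
  have hM0 : 0 < M := by positivity
  have key := lintegral_rpow_le_of_meas_lt_le (μ := μ) (σ := σ) hρm hρ hq2 hM0 hf he ?_
  · refine key.trans (le_of_eq ?_)
    rw [hσq, ← hE, hdq, ENNReal.rpow_add _ _ hE0 hEtop, ENNReal.rpow_one, hM,
      Real.mul_rpow (by positivity) hb0.le, ← mul_assoc,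
      ENNReal.ofReal_mul (q := b ^ (q - 2))
      (by have : 0 < q - 2 := by linarith
          positivity),
      ← ENNReal.ofReal_rpow_of_nonneg hb0.le (by linarith), ← hEb, ← ENNReal.rpow_mul]
    rw [show (1 / 2 : ℝ) * (q - 2) = (q - 2) / 2 by ring]
    ring
  · intro t ht
    set N := (t / M) ^ σ⁻¹ with hN
    have hN0 : 0 < N := by positivity
    have hNσ : N ^ σ = t / M := by
      rw [hN, ← Real.rpow_mul (by positivity), inv_mul_cancel₀ hσ0.ne', Real.rpow_one]
    obtain ⟨l, hlm, hl, hfl⟩ := hsplit N hN0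
    refine (meas_lt_norm_le_of_split hf hlm ht ?_).trans ?_
    · filter_upwards [hl] with x hx
      refine hx.trans ((lintegral_sublevel_sqrt_le ν hρm hρ r _ he).trans ?_)
      rw [← hE, hEb]
      refine (mul_le_mul_left (ENNReal.rpow_le_rpow (hlow N hN0) (by norm_num)) _).trans ?_
      rw [ENNReal.ofReal_rpow_of_nonneg (by positivity) (by norm_num),
        ← ENNReal.ofReal_mul (by positivity)]
      refine ENNReal.ofReal_le_ofReal (le_of_eq ?_)
      rw [Real.mul_rpow hC₁.le (by positivity), ← Real.rpow_mul hN0.le,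
        show (d - 2 * r) * (1 / 2) = σ by rw [hσ]; ring, hNσ, hM]
      field_simp
    · refine mul_le_mul_right (hfl.trans (lintegral_mono_set fun k hk => ?_)) _
      have hk : N < ρ k := hk
      show t < M * ρ k ^ σ
      have := Real.rpow_lt_rpow hN0.le hk hσ0
      rw [hNσ, div_lt_iff₀ hM0] at this
      linarith

/-! ### Plancherel and the Sobolev inequality in velocity -/

theorem eLpNorm_two_sq {α : Type*} [MeasurableSpace α] {μ : Measure α} (f : α → ℂ) :
    eLpNorm f 2 μ ^ 2 = ∫⁻ x, ‖f x‖ₑ ^ (2 : ℝ) ∂μ := by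
  have := eLpNorm_nnreal_pow_eq_lintegral (μ := μ) (f := f) (p := 2) two_ne_zero
  simpa using this

theorem enorm_sq_eq_lintegral {α : Type*} [MeasurableSpace α] {μ : Measure α} (f : Lp ℂ 2 μ) :
    ‖f‖ₑ ^ 2 = ∫⁻ x, ‖f x‖ₑ ^ (2 : ℝ) ∂μ := by
  rw [Lp.enorm_def, eLpNorm_two_sq]

/-- On `L² ∩ L¹`, the Plancherel inverse Fourier transform is given by the integral. -/
theorem fourierInv_Lp_ae_eq_integral (u : Lp ℂ 2 (volume : Measure E3))
    (hu : Integrable u volume) :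
    ((𝓕⁻ u : Lp ℂ 2 (volume : Measure E3)) : E3 → ℂ) =ᵐ[volume] 𝓕⁻ (u : E3 → ℂ) := by
  have hbound : ∀ x, ‖𝓕⁻ (u : E3 → ℂ) x‖ ≤ ∫ v, ‖u v‖ := fun x =>
    VectorFourier.norm_fourierIntegral_le_integral_norm _ _ _ _ _
  have hcont : Continuous (𝓕⁻ (u : E3 → ℂ)) :=
    VectorFourier.fourierIntegral_continuous Real.continuous_fourierChar
      (L := -innerₗ E3) (continuous_inner (𝕜 := ℝ) (E := E3)).neg hu
  -- Both functions are locally integrable, so testing against smooth compactly supported functions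
  -- suffices. The transform moves onto the test function: by duality for the Plancherel version, by
  -- Fubini for the integral.
  refine ae_eq_of_integral_contDiff_smul_eq ((Lp.memLp _).locallyIntegrable one_le_two)
    hcont.locallyIntegrable fun g hg hgc => ?_
  have hg₁ : HasCompactSupport (Complex.ofRealCLM ∘ g) := hgc.comp_left rfl
  have hg₂ : ContDiff ℝ (⊤ : ℕ∞) (Complex.ofRealCLM ∘ g) := by fun_prop
  set φ : 𝓢(E3, ℂ) := hg₁.toSchwartzMap hg₂ with hφ
  have hφg : ∀ x, φ x = (g x : ℂ) := fun x => rfl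
  have h1 := DFunLike.congr_fun (Lp.fourierInv_toTemperedDistribution_eq u) φ
  rw [TemperedDistribution.fourierInv_apply, Lp.toTemperedDistribution_apply,
    Lp.toTemperedDistribution_apply] at h1
  have h2 : ∫ x, (𝓕⁻ φ) x • u x = ∫ x, φ x • 𝓕⁻ (u : E3 → ℂ) x := by
    have B : Continuous fun p : E3 × E3 => (-innerₗ E3) p.1 p.2 :=
      (continuous_inner (𝕜 := ℝ) (E := E3)).neg
    have := VectorFourier.integral_fourierIntegral_smul_eq_flip (L := -innerₗ E3)
      Real.continuous_fourierChar B (φ.integrable (μ := volume)) hu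
    rw [SchwartzMap.fourierInv_coe]
    have hflip : (-innerₗ E3).flip = -innerₗ E3 := by
      ext x y; simp [real_inner_comm]
    rw [hflip] at this
    exact this
  calc ∫ x, g x • (𝓕⁻ u : Lp ℂ 2 (volume : Measure E3)) x
      = ∫ x, φ x • (𝓕⁻ u : Lp ℂ 2 (volume : Measure E3)) x := by
        simp [hφg]
    _ = ∫ x, φ x • 𝓕⁻ (u : E3 → ℂ) x := by rw [← h1, h2]
    _ = _ := by simp [hφg]

theorem enorm_fourierInv_Lp_le (u : Lp ℂ 2 (volume : Measure E3)) (hu : Integrable u volume) :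
    ∀ᵐ x : E3, ‖(𝓕⁻ u : Lp ℂ 2 (volume : Measure E3)) x‖ₑ ≤ ∫⁻ v, ‖u v‖ₑ := by
  filter_upwards [fourierInv_Lp_ae_eq_integral u hu] with x hx
  rw [hx]
  have : ‖𝓕⁻ (u : E3 → ℂ) x‖ ≤ ∫ v, ‖u v‖ :=
    VectorFourier.norm_fourierIntegral_le_integral_norm _ _ _ _ _
  rw [← ofReal_integral_norm_eq_lintegral_enorm hu, ← ofReal_norm]
  exact ENNReal.ofReal_le_ofReal this

theorem enorm_fourierInv_Lp (u : Lp ℂ 2 (volume : Measure E3)) :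
    ‖(𝓕⁻ u : Lp ℂ 2 (volume : Measure E3))‖ₑ = ‖u‖ₑ := by
  have := Lp.norm_fourier_eq (𝓕⁻ u : Lp ℂ 2 (volume : Measure E3))
  rw [FourierTransform.fourier_fourierInv_eq] at this
  rw [← ofReal_norm, ← ofReal_norm, this]

theorem bracketPow_pos (a : ℝ) (v : E3) : 0 < bracketPow a v :=
  Real.rpow_pos_of_pos (by positivity) _

theorem measurable_bracketPow (a : ℝ) : Measurable (bracketPow a) := by
  unfold bracketPow; fun_prop

theorem bracketPow_rpow (a b : ℝ) (v : E3) : bracketPow a v ^ b = bracketPow (a * b) v := by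
  unfold bracketPow
  rw [← Real.rpow_mul (by positivity)]
  congr 1; ring

theorem bracketPow_mono {a b : ℝ} (h : a ≤ b) (v : E3) : bracketPow a v ≤ bracketPow b v :=
  Real.rpow_le_rpow_of_exponent_le (le_add_of_nonneg_right (sq_nonneg _)) (by linarith)

theorem norm_le_bracketPow_one (v : E3) : ‖v‖ ≤ bracketPow 1 v := by
  unfold bracketPow
  rw [← Real.sqrt_eq_rpow]
  exact Real.le_sqrt_of_sq_le (by linarith)

/-- The Sobolev inequality on `ℝ³`. -/
theorem exists_sobolev_velocity {r s : ℝ} (hr : 0 < r) (hr3 : 2 * r < 3) (hrs : r ≤ s) :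
    ∃ C : ℝ, 0 < C ∧ ∀ f g : E3 → ℂ, IsDvPow s f g →
      (∫⁻ v, ‖f v‖ₑ ^ (2 * 3 / (3 - 2 * r))) ^ ((3 - 2 * r) / 3) ≤
        ENNReal.ofReal C * ∫⁻ v, ‖g v‖ₑ ^ (2 : ℝ) := by
  set ρ : E3 → ℝ := fun ξ => bracketPow 1 ((2 * Real.pi) • ξ) with hρdef
  have hρm : Measurable ρ := (measurable_bracketPow 1).comp (measurable_const_smul _)
  have hρ : ∀ ξ, 0 < ρ ξ := fun ξ => bracketPow_pos _ _
  have hball : ∀ N : ℝ, {ξ | ρ ξ ≤ N} ⊆ Metric.closedBall 0 N := by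
    intro N ξ hξ
    rw [mem_closedBall_zero_iff]
    have h1 := norm_le_bracketPow_one ((2 * Real.pi) • ξ)
    rw [norm_smul, Real.norm_of_nonneg Real.two_pi_pos.le] at h1
    -- Since 2π ≥ 1, the ball of radius N contains the sublevel set; the sharper radius N/(2π) is
    -- not needed.
    have h2 : ‖ξ‖ ≤ 2 * Real.pi * ‖ξ‖ :=
      le_mul_of_one_le_left (norm_nonneg _) (by linarith [Real.pi_gt_three])
    exact h2.trans (h1.trans hξ)
  have hfin : ∀ N : ℝ, volume {ξ | ρ ξ ≤ N} < ∞ := fun N =>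
    (measure_mono (hball N)).trans_lt measure_closedBall_lt_top
  set K₀ : ℝ := (volume (Metric.ball (0 : E3) 1)).toReal
  have hcount : ∀ N : ℝ, 0 < N → volume {ξ | ρ ξ ≤ N} ≤ ENNReal.ofReal (K₀ * N ^ (3 : ℝ)) := by
    intro N hN
    refine (measure_mono (hball N)).trans (le_of_eq ?_)
    rw [Measure.addHaar_closedBall _ _ hN.le, ENNReal.ofReal_mul ENNReal.toReal_nonneg,
      ENNReal.ofReal_toReal measure_ball_lt_top.ne, mul_comm]
    congr 2
    simp only [finrank_euclideanSpace, Fintype.card_fin]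
    norm_cast
  obtain ⟨C, hC, hsob⟩ := exists_sobolev_of_frequency_split (volume : Measure E3)
    (volume : Measure E3) hρm hρ hr hr3 ENNReal.toReal_nonneg hcount
  have h3r : 0 < 3 - 2 * r := by linarith
  refine ⟨C ^ ((3 - 2 * r) / 3), by positivity, fun f g hfg => ?_⟩
  obtain ⟨hf, hg, hfg⟩ := hfg
  set fh : Lp ℂ 2 (volume : Measure E3) := 𝓕 (hf.toLp f) with hfh
  have hefh : AEStronglyMeasurable fh volume := (Lp.aestronglyMeasurable fh)
  have key := hsob f (fun ξ => ‖fh ξ‖ₑ ^ (2 : ℝ)) hf.1 (hefh.enorm.pow_const _) ?_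
  · have h1 : ∫⁻ ξ, ENNReal.ofReal (ρ ξ ^ (2 * r)) * ‖fh ξ‖ₑ ^ (2 : ℝ) ≤
        ∫⁻ v, ‖g v‖ₑ ^ (2 : ℝ) := by
      have h2 : ∫⁻ v, ‖g v‖ₑ ^ (2 : ℝ) =
          ∫⁻ ξ, ‖(𝓕 (hg.toLp g) : Lp ℂ 2 (volume : Measure E3)) ξ‖ₑ ^ (2 : ℝ) := by
        rw [← enorm_sq_eq_lintegral, ← ofReal_norm, Lp.norm_fourier_eq, ofReal_norm,
          enorm_sq_eq_lintegral]
        refine lintegral_congr_ae ?_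
        filter_upwards [hg.coeFn_toLp] with v hv
        rw [hv]
      rw [h2]
      refine lintegral_mono_ae ?_
      filter_upwards [hfg] with ξ hξ
      rw [hξ, enorm_mul, ENNReal.mul_rpow_of_nonneg _ _ zero_le_two]
      refine mul_le_mul_left ?_ _
      rw [← ofReal_norm, Complex.norm_of_nonneg (bracketPow_pos _ _).le,
        ENNReal.ofReal_rpow_of_nonneg (bracketPow_pos _ _).le zero_le_two,
        bracketPow_rpow, bracketPow_rpow]
      exact ENNReal.ofReal_le_ofReal (bracketPow_mono (by linarith) _)
    calc _ ≤ (ENNReal.ofReal C * (∫⁻ v, ‖g v‖ₑ ^ (2 : ℝ)) ^ (3 / (3 - 2 * r))) ^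
          ((3 - 2 * r) / 3) := by
          refine ENNReal.rpow_le_rpow (key.trans ?_) (by positivity)
          gcongr
      _ = _ := by
          rw [ENNReal.mul_rpow_of_nonneg _ _ (by positivity), ← ENNReal.rpow_mul,
            ENNReal.ofReal_rpow_of_nonneg hC.le (by positivity)]
          rw [show 3 / (3 - 2 * r) * ((3 - 2 * r) / 3) = 1 by field_simp, ENNReal.rpow_one]
  · intro N hN
    have hA : MeasurableSet {ξ | ρ ξ ≤ N} := measurableSet_le hρm measurable_const
    -- The low part is the inverse transform of the sharp frequency cutoff. The cutoff has support
    -- of finite measure, so it is integrable as well as square integrable and its inverse transform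
    -- is bounded.
    have humem : MemLp ({ξ | ρ ξ ≤ N}.indicator fh) 2 volume := (Lp.memLp fh).indicator hA
    set u := humem.toLp with hu
    have hucoe : u =ᵐ[volume] {ξ | ρ ξ ≤ N}.indicator fh := humem.coeFn_toLp
    have huint : Integrable u volume := by
      refine (integrable_congr hucoe).2 ?_
      rw [integrable_indicator_iff hA]
      have : IsFiniteMeasure (volume.restrict {ξ | ρ ξ ≤ N}) :=
        isFiniteMeasure_restrict.2 (hfin N).ne
      exact ((Lp.memLp fh).restrict _).integrable one_le_two
    refine ⟨(𝓕⁻ u : Lp ℂ 2 (volume : Measure E3)), Lp.aestronglyMeasurable _, ?_, ?_⟩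
    · filter_upwards [enorm_fourierInv_Lp_le u huint] with x hx
      refine hx.trans (le_of_eq ?_)
      rw [← lintegral_indicator hA]
      refine lintegral_congr_ae ?_
      filter_upwards [hucoe] with ξ hξ
      rw [hξ]
      by_cases h : ξ ∈ {ξ | ρ ξ ≤ N}
      · rw [indicator_of_mem h, indicator_of_mem h, ← ENNReal.rpow_mul]; norm_num
      · rw [indicator_of_notMem h, indicator_of_notMem h, enorm_zero]
    · have h1 : ∫⁻ x, ‖f x - (𝓕⁻ u : Lp ℂ 2 (volume : Measure E3)) x‖ₑ ^ (2 : ℝ) =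
          ‖𝓕⁻ (fh - u)‖ₑ ^ 2 := by
        have h2 : 𝓕⁻ (fh - u) = hf.toLp f - 𝓕⁻ u := by
          have h3 : 𝓕⁻ (fh - u) = 𝓕⁻ fh - 𝓕⁻ u := (Lp.fourierTransformₗᵢ E3 ℂ).symm.map_sub fh u
          rw [h3, hfh, FourierTransform.fourierInv_fourier_eq]
        rw [h2, enorm_sq_eq_lintegral]
        refine lintegral_congr_ae ?_
        filter_upwards [hf.coeFn_toLp, Lp.coeFn_sub (hf.toLp f) (𝓕⁻ u)] with x hx hx2
        rw [hx2, Pi.sub_apply, hx]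
      rw [h1, enorm_fourierInv_Lp, enorm_sq_eq_lintegral,
        ← lintegral_indicator (measurableSet_lt measurable_const hρm)]
      refine lintegral_mono_ae ?_
      filter_upwards [hucoe, Lp.coeFn_sub fh u] with ξ h1 h2
      rw [h2, Pi.sub_apply, h1]
      by_cases h : ρ ξ ≤ N
      · simp [indicator, h, not_lt.2 h]
      · simp [indicator, h, not_le.1 h]

/-! ### Fourier series and the Sobolev inequality on the unit torus -/

/-- The torus of side `1`, on which the multivariate Fourier basis of Mathlib lives. -/
abbrev U3 : Type := UnitAddTorus (Fin 3)

/-- The probability Haar measure of `U3`. -/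
def haarU3 : Measure U3 := Measure.pi fun _ => AddCircle.haarAddCircle

instance : IsProbabilityMeasure haarU3 := by unfold haarU3; infer_instance

/-- `⟨k⟩ = (1 + |k|²)^{1/2}` for `k ∈ ℤ³`. -/
def latticeBracket (k : Fin 3 → ℤ) : ℝ := (1 + ∑ j, (k j : ℝ) ^ 2) ^ (1 / 2 : ℝ)

theorem latticeBracket_pos (k : Fin 3 → ℤ) : 0 < latticeBracket k :=
  Real.rpow_pos_of_pos (by positivity) _

theorem latticeBracket_rpow (k : Fin 3 → ℤ) (r : ℝ) :
    latticeBracket k ^ (2 * r) = (1 + ∑ j, (k j : ℝ) ^ 2) ^ r := by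
  unfold latticeBracket
  rw [← Real.rpow_mul (by positivity)]
  congr 1; ring

theorem latticeBracket_le_subset (N : ℝ) :
    {k | latticeBracket k ≤ N} ⊆
      (Fintype.piFinset fun _ : Fin 3 => Finset.Icc (-⌊N⌋) ⌊N⌋ : Finset (Fin 3 → ℤ)) := by
  intro k hk
  have hk : latticeBracket k ≤ N := hk
  simp only [Finset.mem_coe, Fintype.mem_piFinset, Finset.mem_Icc]
  intro j
  have h : |(k j : ℝ)| ≤ N := by
    refine le_trans ?_ hk
    unfold latticeBracket
    rw [← Real.sqrt_eq_rpow]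
    refine Real.le_sqrt_of_sq_le ?_
    rw [sq_abs]
    have := Finset.single_le_sum (f := fun j => (k j : ℝ) ^ 2) (fun i _ => sq_nonneg _)
      (Finset.mem_univ j)
    linarith
  rw [abs_le] at h
  refine ⟨?_, Int.le_floor.2 h.2⟩
  rw [neg_le]
  refine Int.le_floor.2 ?_
  push_cast
  linarith

/-- For N < 1 the set is empty because the bracket is at least 1. For N ≥ 1 the enclosing box has
(2⌊N⌋+1)³ ≤ (3N)³ points, hence 27. -/
theorem count_latticeBracket_le {N : ℝ} (hN : 0 < N) :
    (Measure.count : Measure (Fin 3 → ℤ)) {k | latticeBracket k ≤ N} ≤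
      ENNReal.ofReal (27 * N ^ (3 : ℝ)) := by
  rcases lt_or_ge N 1 with h1 | h1
  · have : {k | latticeBracket k ≤ N} = ∅ := by
      refine eq_empty_of_forall_notMem fun k hk => ?_
      have hk : latticeBracket k ≤ N := hk
      have : 1 ≤ latticeBracket k := Real.one_le_rpow
        (le_add_of_nonneg_right (Finset.sum_nonneg fun i _ => sq_nonneg _)) (by norm_num)
      linarith
    rw [this, measure_empty]
    exact zero_le
  · refine (measure_mono (latticeBracket_le_subset N)).trans ?_
    rw [Measure.count_apply_finset, Fintype.card_piFinset]
    simp only [Int.card_Icc, Finset.prod_const, Finset.card_univ, Fintype.card_fin]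
    rw [← ENNReal.ofReal_natCast]
    refine ENNReal.ofReal_le_ofReal ?_
    have hf : (0 : ℤ) ≤ ⌊N⌋ := Int.floor_nonneg.2 hN.le
    have e : (((⌊N⌋ + 1 - -⌊N⌋).toNat : ℕ) : ℝ) = 2 * (⌊N⌋ : ℝ) + 1 := by
      have : (((⌊N⌋ + 1 - -⌊N⌋).toNat : ℕ) : ℤ) = 2 * ⌊N⌋ + 1 := by
        rw [Int.toNat_of_nonneg (by linarith)]; ring
      exact_mod_cast this
    push_cast
    rw [e]
    have hfN : (⌊N⌋ : ℝ) ≤ N := Int.floor_le N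
    have hf0 : (0 : ℝ) ≤ ⌊N⌋ := by exact_mod_cast hf
    calc (2 * (⌊N⌋ : ℝ) + 1) ^ 3 ≤ (3 * N) ^ 3 := by gcongr; linarith
      _ = 27 * N ^ (3 : ℝ) := by norm_cast; ring

theorem norm_mFourier_apply (k : Fin 3 → ℤ) (x : U3) : ‖UnitAddTorus.mFourier k x‖ = 1 := by
  simp only [UnitAddTorus.mFourier, ContinuousMap.coe_mk, norm_prod, fourier_apply]
  exact Finset.prod_eq_one fun b _ => Circle.norm_coe _

section UnitTorus

-- Makes `volume` on `U3` unfold to `haarU3`, so that Fourier-series statements phrased with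
-- `volume` apply to it.
local instance unitAddCircleHaarSpace : MeasureSpace UnitAddCircle := ⟨AddCircle.haarAddCircle⟩

theorem lintegral_sq_eq_tsum_mFourierCoeff {F : U3 → ℂ} (hF : MemLp F 2 haarU3) :
    ∫⁻ x, ‖F x‖ₑ ^ (2 : ℝ) ∂haarU3 =
      ∑' k, ‖∫ t, UnitAddTorus.mFourier (-k) t * F t ∂haarU3‖ₑ ^ (2 : ℝ) := by
  have hF' : MemLp F 2 (volume : Measure U3) := hF
  have h := UnitAddTorus.hasSum_sq_mFourierCoeff (hF'.toLp F)
  have hc : ∀ k, UnitAddTorus.mFourierCoeff (hF'.toLp F) k =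
      ∫ t, UnitAddTorus.mFourier (-k) t * F t ∂haarU3 := by
    intro k
    refine integral_congr_ae ?_
    filter_upwards [hF'.coeFn_toLp] with x hx
    rw [hx, smul_eq_mul]
  simp only [hc] at h
  have h1 : ∫⁻ x, ‖F x‖ₑ ^ (2 : ℝ) ∂haarU3 =
      ENNReal.ofReal (∫ x, ‖hF'.toLp F x‖ ^ 2) := by
    rw [ofReal_integral_eq_lintegral_ofReal]
    · refine lintegral_congr_ae ?_
      filter_upwards [hF'.coeFn_toLp] with x hx
      rw [hx, ENNReal.ofReal_pow (norm_nonneg _), ofReal_norm]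
      norm_cast
    · exact (memLp_two_iff_integrable_sq_norm (Lp.aestronglyMeasurable _)).1 (Lp.memLp _)
    · exact Filter.Eventually.of_forall fun x => sq_nonneg _
  rw [h1, ← h.tsum_eq, ENNReal.ofReal_tsum_of_nonneg (fun k => sq_nonneg _) h.summable]
  refine tsum_congr fun k => ?_
  rw [ENNReal.ofReal_pow (norm_nonneg _), ofReal_norm]
  norm_cast

theorem mFourierCoeff_mFourier (k n : Fin 3 → ℤ) :
    ∫ t, UnitAddTorus.mFourier (-k) t * UnitAddTorus.mFourier n t ∂haarU3 =
      if k = n then 1 else 0 := by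
  have h := orthonormal_iff_ite.1 (UnitAddTorus.orthonormal_mFourier (d := Fin 3)) k n
  rw [ContinuousMap.inner_toLp] at h
  rw [← h]
  refine integral_congr_ae (Filter.Eventually.of_forall fun t => ?_)
  simp only [UnitAddTorus.mFourier_neg]
  ring

end UnitTorus

/-- The Sobolev inequality on the unit torus. -/
theorem exists_sobolev_unitTorus {r : ℝ} (hr : 0 < r) (hr3 : 2 * r < 3) :
    ∃ C : ℝ, 0 < C ∧ ∀ F : U3 → ℂ, MemLp F 2 haarU3 →
      ∫⁻ x, ‖F x‖ₑ ^ (2 * 3 / (3 - 2 * r)) ∂haarU3 ≤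
        ENNReal.ofReal C * (∑' k, ENNReal.ofReal (latticeBracket k ^ (2 * r)) *
          ‖∫ t, UnitAddTorus.mFourier (-k) t * F t ∂haarU3‖ₑ ^ (2 : ℝ)) ^ (3 / (3 - 2 * r)) := by
  have hρm : Measurable latticeBracket := measurable_of_countable _
  obtain ⟨C, hC, hsob⟩ := exists_sobolev_of_frequency_split haarU3
    (Measure.count : Measure (Fin 3 → ℤ)) hρm latticeBracket_pos hr hr3 (K₀ := 27) (by norm_num)
    (fun N hN => count_latticeBracket_le hN)
  refine ⟨C, hC, fun F hF => ?_⟩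
  set c : (Fin 3 → ℤ) → ℂ := fun k => ∫ t, UnitAddTorus.mFourier (-k) t * F t ∂haarU3 with hc
  rw [← lintegral_count]
  refine hsob F (fun k => ‖c k‖ₑ ^ (2 : ℝ)) hF.1 (measurable_of_countable _).aemeasurable ?_
  intro N hN
  have hSfin : {k | latticeBracket k ≤ N}.Finite :=
    (Finset.finite_toSet _).subset (latticeBracket_le_subset N)
  set S := hSfin.toFinset with hS
  have hmemS : ∀ k, k ∈ S ↔ latticeBracket k ≤ N := fun k => by simp [hS]
  -- The low part is the partial Fourier sum: it is bounded by the sum of its coefficients' moduli,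
  -- and Parseval gives the tail for the remainder.
  set l : U3 → ℂ := fun x => ∑ k ∈ S, c k * UnitAddTorus.mFourier k x with hl
  have hlc : Continuous l := by fun_prop
  refine ⟨l, hlc.aestronglyMeasurable, Filter.Eventually.of_forall fun x => ?_, ?_⟩
  · calc ‖l x‖ₑ ≤ ∑ k ∈ S, ‖c k * UnitAddTorus.mFourier k x‖ₑ := enorm_sum_le _ _
      _ = ∑ k ∈ S, (‖c k‖ₑ ^ (2 : ℝ)) ^ (1 / 2 : ℝ) := by
          refine Finset.sum_congr rfl fun k _ => ?_
          have h1 : ‖UnitAddTorus.mFourier k x‖ₑ = 1 := by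
            rw [← ofReal_norm, norm_mFourier_apply, ENNReal.ofReal_one]
          rw [enorm_mul, h1, mul_one, ← ENNReal.rpow_mul]
          norm_num
      _ = _ := by
          rw [← lintegral_indicator (measurableSet_le hρm measurable_const), lintegral_count,
            tsum_eq_sum (s := S)]
          · refine Finset.sum_congr rfl fun k hk => ?_
            rw [indicator_of_mem]
            exact (hmemS k).1 hk
          · intro k hk
            rw [indicator_of_notMem]
            exact fun h => hk ((hmemS k).2 h)
  · have hlmem : MemLp l 2 haarU3 :=
      MemLp.of_bound hlc.aestronglyMeasurable (∑ k ∈ S, ‖c k‖)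
        (Filter.Eventually.of_forall fun x => by
          refine (norm_sum_le _ _).trans (Finset.sum_le_sum fun k _ => ?_)
          rw [norm_mul, norm_mFourier_apply, mul_one])
    have hpars := lintegral_sq_eq_tsum_mFourierCoeff (hF.sub hlmem)
    have hint : ∀ k, Integrable (fun t => UnitAddTorus.mFourier (-k) t * F t) haarU3 := by
      intro k
      refine (hF.integrable one_le_two).bdd_mul
        (UnitAddTorus.mFourier (-k)).continuous.aestronglyMeasurable (c := 1)
        (Filter.Eventually.of_forall fun x => (norm_mFourier_apply _ x).le)
    have hcint : ∀ {φ : U3 → ℂ}, Continuous φ → Integrable φ haarU3 := fun {φ} hφ => by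
      obtain ⟨B, hB⟩ := (isCompact_range hφ).isBounded.exists_norm_le
      exact (MemLp.of_bound (p := 1) hφ.aestronglyMeasurable B
        (Filter.Eventually.of_forall fun x => hB _ (mem_range_self x))).integrable le_rfl
    have hcoef : ∀ k, ∫ t, UnitAddTorus.mFourier (-k) t * (F - l) t ∂haarU3 =
        if k ∈ S then 0 else c k := by
      intro k
      have e1 : ∀ t, UnitAddTorus.mFourier (-k) t * (F - l) t =
          UnitAddTorus.mFourier (-k) t * F t - ∑ n ∈ S,
            c n * (UnitAddTorus.mFourier (-k) t * UnitAddTorus.mFourier n t) := by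
        intro t
        simp only [Pi.sub_apply, hl, mul_sub, Finset.mul_sum]
        congr 1
        refine Finset.sum_congr rfl fun n _ => by ring
      simp_rw [e1]
      rw [integral_sub (hint k) (hcint (by fun_prop)),
        integral_finsetSum _ (fun n _ => hcint (by fun_prop))]
      simp_rw [integral_const_mul, mFourierCoeff_mFourier]
      by_cases h : k ∈ S
      · simp [h, hc]
      · simp [h, hc]
    have hpars' : ∫⁻ x, ‖F x - l x‖ₑ ^ (2 : ℝ) ∂haarU3 =
        ∑' k, ‖(if k ∈ S then 0 else c k : ℂ)‖ₑ ^ (2 : ℝ) := by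
      refine Eq.trans hpars (tsum_congr fun k => ?_)
      rw [hcoef k]
    rw [hpars', ← lintegral_indicator (measurableSet_lt measurable_const hρm), lintegral_count]
    refine le_of_eq (tsum_congr fun k => ?_)
    by_cases h : latticeBracket k ≤ N
    · simp [(hmemS k).2 h, indicator, not_lt.2 h]
    · simp [mt (hmemS k).1 h, indicator, not_le.1 h]

/-! ### Transfer to the torus of side 2π -/

/-- The rescaling of the torus to the unit torus. -/
def rescaleTorus : T3 ≃ₜ U3 :=
  Homeomorph.piCongrRight fun _ => AddCircle.homeomorphAddCircle (2 * Real.pi) 1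
    Real.two_pi_pos.ne' one_ne_zero

theorem fourier_homeomorphAddCircle (n : ℤ) (x : AddCircle (2 * Real.pi)) :
    fourier n (AddCircle.homeomorphAddCircle (2 * Real.pi) 1
      Real.two_pi_pos.ne' one_ne_zero x) = fourier n x := by
  induction x using QuotientAddGroup.induction_on with
  | H y =>
    erw [AddCircle.homeomorphAddCircle_apply_mk]
    rw [fourier_coe_apply, fourier_coe_apply]
    congr 1
    push_cast
    have : (Real.pi : ℂ) ≠ 0 := by exact_mod_cast Real.pi_ne_zero
    field_simp

theorem mFourier_rescaleTorus (k : Fin 3 → ℤ) (x : T3) :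
    UnitAddTorus.mFourier k (rescaleTorus x) = ∏ j, fourier (k j) (x j) := by
  show ∏ j, fourier (k j) (rescaleTorus x j) = _
  exact Finset.prod_congr rfl fun j _ => fourier_homeomorphAddCircle (k j) (x j)

/-- On each circle the image of the Haar probability measure is again one, so uniqueness of Haar
measure applies; the volume carries a factor 2π per coordinate. -/
theorem map_rescaleTorus_volume :
    Measure.map rescaleTorus (volume : Measure T3) =
      ENNReal.ofReal (2 * Real.pi) ^ 3 • haarU3 := by
  set e : AddCircle (2 * Real.pi) ≃ₜ UnitAddCircle :=
    AddCircle.homeomorphAddCircle (2 * Real.pi) 1 Real.two_pi_pos.ne' one_ne_zero with he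
  have hmap : Measure.map e (AddCircle.haarAddCircle (T := 2 * Real.pi)) =
      (AddCircle.haarAddCircle : Measure UnitAddCircle) := by
    have h1 : Measure.IsAddHaarMeasure
        (Measure.map e (AddCircle.haarAddCircle (T := 2 * Real.pi))) :=
      (AddCircle.equivAddCircle (2 * Real.pi) 1 Real.two_pi_pos.ne'
        one_ne_zero).isAddHaarMeasure_map _ e.continuous e.symm.continuous
    have h2 : IsProbabilityMeasure
        (Measure.map e (AddCircle.haarAddCircle (T := 2 * Real.pi))) :=
      Measure.isProbabilityMeasure_map e.continuous.measurable.aemeasurable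
    exact Measure.isAddHaarMeasure_eq_of_isProbabilityMeasure _ _
  have hmp : MeasurePreserving e volume
      (ENNReal.ofReal (2 * Real.pi) • (AddCircle.haarAddCircle : Measure UnitAddCircle)) := by
    refine ⟨e.continuous.measurable, ?_⟩
    rw [AddCircle.volume_eq_smul_haarAddCircle, Measure.map_smul, hmap]
  have hσ : SigmaFinite
      (ENNReal.ofReal (2 * Real.pi) • (AddCircle.haarAddCircle : Measure UnitAddCircle)) := by
    have : IsFiniteMeasure
        (ENNReal.ofReal (2 * Real.pi) • (AddCircle.haarAddCircle : Measure UnitAddCircle)) :=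
      Measure.smul_finite _ ENNReal.ofReal_ne_top
    infer_instance
  have hpi := (measurePreserving_pi (fun _ : Fin 3 => (volume : Measure (AddCircle (2 * Real.pi))))
    (fun _ : Fin 3 => ENNReal.ofReal (2 * Real.pi) •
      (AddCircle.haarAddCircle : Measure UnitAddCircle)) (f := fun _ => e) fun _ => hmp).map_eq
  refine Eq.trans hpi (Measure.pi_eq fun s hs => ?_)
  rw [Measure.smul_apply, haarU3, Measure.pi_pi]
  simp [Finset.prod_mul_distrib]

theorem lintegral_comp_rescaleTorus (Φ : U3 → ℝ≥0∞) :
    ∫⁻ x : T3, Φ (rescaleTorus x) =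
      ENNReal.ofReal (2 * Real.pi) ^ 3 * ∫⁻ y, Φ y ∂haarU3 := by
  have h := lintegral_map_equiv (μ := (volume : Measure T3)) Φ rescaleTorus.toMeasurableEquiv
  have h' : ∫⁻ x : T3, Φ (rescaleTorus x) = ∫⁻ y, Φ y ∂(Measure.map rescaleTorus volume) := h.symm
  rw [h', map_rescaleTorus_volume, lintegral_smul_measure, smul_eq_mul]

theorem integral_comp_rescaleTorus (Φ : U3 → ℂ) :
    ∫ x : T3, Φ (rescaleTorus x) = ((2 * Real.pi) ^ 3 : ℝ) • ∫ y, Φ y ∂haarU3 := by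
  have h := integral_smul_measure Φ (ENNReal.ofReal (2 * Real.pi) ^ 3) (μ := haarU3)
  rw [ENNReal.toReal_pow, ENNReal.toReal_ofReal Real.two_pi_pos.le] at h
  rw [← h, ← map_rescaleTorus_volume]
  exact (integral_map_equiv rescaleTorus.toMeasurableEquiv Φ).symm

theorem memLp_comp_rescaleTorus_symm {f : T3 → ℂ} (hf : MemLp f 2 volume) :
    MemLp (f ∘ rescaleTorus.symm) 2 haarU3 := by
  have h1 : MemLp (f ∘ rescaleTorus.symm) 2 (Measure.map rescaleTorus (volume : Measure T3)) := by
    refine (rescaleTorus.toMeasurableEquiv.measurableEmbedding.memLp_map_measure_iff).2 ?_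
    convert! hf using 1
    ext x
    simp
  rw [map_rescaleTorus_volume] at h1
  have hc : ENNReal.ofReal (2 * Real.pi) ^ 3 ≠ 0 :=
    pow_ne_zero _ (ENNReal.ofReal_pos.2 Real.two_pi_pos).ne'
  have := h1.smul_measure (c := (ENNReal.ofReal (2 * Real.pi) ^ 3)⁻¹) (ENNReal.inv_ne_top.2 hc)
  rwa [smul_smul, ENNReal.inv_mul_cancel hc (ENNReal.pow_ne_top ENNReal.ofReal_ne_top),
    one_smul] at this

theorem torusFourier_eq_smul (f : T3 → ℂ) (k : Fin 3 → ℤ) :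
    torusFourier f k = ((2 * Real.pi) ^ 3 : ℝ) •
      ∫ t, UnitAddTorus.mFourier (-k) t * (f ∘ rescaleTorus.symm) t ∂haarU3 := by
  rw [← integral_comp_rescaleTorus]
  simp [mFourier_rescaleTorus, torusFourier]

/-- The Sobolev inequality on the torus. -/
theorem exists_sobolev_torus {r : ℝ} (hr : 0 < r) (hr3 : 2 * r < 3) :
    ∃ C : ℝ, 0 < C ∧ ∀ f g : T3 → ℂ, IsDxPow r f g →
      (∫⁻ x, ‖f x‖ₑ ^ (2 * 3 / (3 - 2 * r))) ^ ((3 - 2 * r) / 3) ≤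
        ENNReal.ofReal C * ∫⁻ x, ‖g x‖ₑ ^ (2 : ℝ) := by
  obtain ⟨C, hC, hsob⟩ := exists_sobolev_unitTorus hr hr3
  have h3r : 0 < 3 - 2 * r := by linarith
  set V : ℝ := (2 * Real.pi) ^ 3 with hV
  have hV0 : 0 < V := by have := Real.two_pi_pos; positivity
  have hVe : ENNReal.ofReal (2 * Real.pi) ^ 3 = ENNReal.ofReal V := by
    exact (ENNReal.ofReal_pow Real.two_pi_pos.le 3).symm
  -- The volume factor V enters the left side inside the power (3-2r)/3, while V⁻¹ undoes its
  -- appearance in the integral of |g|².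
  refine ⟨(V * C) ^ ((3 - 2 * r) / 3) * V⁻¹, by positivity, fun f g hfg => ?_⟩
  obtain ⟨hf, hg, hfg⟩ := hfg
  have hcoef : ∀ k, ∫ t, UnitAddTorus.mFourier (-k) t * (g ∘ rescaleTorus.symm) t ∂haarU3 =
      (((1 + ∑ j, (k j : ℝ) ^ 2) ^ (r / 2) : ℝ) : ℂ) *
        ∫ t, UnitAddTorus.mFourier (-k) t * (f ∘ rescaleTorus.symm) t ∂haarU3 := by
    intro k
    have h := hfg k
    rw [torusFourier_eq_smul, torusFourier_eq_smul, mul_smul_comm] at h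
    exact smul_right_injective ℂ hV0.ne' h
  have hF := hsob _ (memLp_comp_rescaleTorus_symm hf)
  have hG := lintegral_sq_eq_tsum_mFourierCoeff (memLp_comp_rescaleTorus_symm hg)
  have hsum : (∑' k, ENNReal.ofReal (latticeBracket k ^ (2 * r)) *
      ‖∫ t, UnitAddTorus.mFourier (-k) t * (f ∘ rescaleTorus.symm) t ∂haarU3‖ₑ ^ (2 : ℝ)) =
      ∫⁻ x, ‖(g ∘ rescaleTorus.symm) x‖ₑ ^ (2 : ℝ) ∂haarU3 := by
    rw [hG]
    refine tsum_congr fun k => ?_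
    have hp : (0 : ℝ) ≤ 1 + ∑ j, (k j : ℝ) ^ 2 := by positivity
    rw [hcoef k, enorm_mul, ENNReal.mul_rpow_of_nonneg _ _ zero_le_two]
    congr 1
    rw [← ofReal_norm, Complex.norm_of_nonneg (Real.rpow_nonneg hp _),
      ENNReal.ofReal_rpow_of_nonneg (Real.rpow_nonneg hp _) zero_le_two, ← Real.rpow_mul hp,
      latticeBracket_rpow]
    congr 2; ring
  rw [hsum] at hF
  have hf' := lintegral_comp_rescaleTorus
    (fun y => ‖(f ∘ rescaleTorus.symm) y‖ₑ ^ (2 * 3 / (3 - 2 * r)))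
  have hg' := lintegral_comp_rescaleTorus (fun y => ‖(g ∘ rescaleTorus.symm) y‖ₑ ^ (2 : ℝ))
  simp only [Function.comp, Homeomorph.symm_apply_apply, hVe] at hf' hg' hF
  rw [hf', hg']
  set I := ∫⁻ y, ‖g (rescaleTorus.symm y)‖ₑ ^ (2 : ℝ) ∂haarU3
  calc _ ≤ (ENNReal.ofReal V * (ENNReal.ofReal C * I ^ (3 / (3 - 2 * r)))) ^
        ((3 - 2 * r) / 3) := by gcongr
    _ = ENNReal.ofReal ((V * C) ^ ((3 - 2 * r) / 3)) * I := by
        rw [← mul_assoc, ← ENNReal.ofReal_mul hV0.le,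
          ENNReal.mul_rpow_of_nonneg _ _ (by positivity), ← ENNReal.rpow_mul,
          ENNReal.ofReal_rpow_of_nonneg (by positivity) (by positivity),
          show 3 / (3 - 2 * r) * ((3 - 2 * r) / 3) = 1 by field_simp, ENNReal.rpow_one]
    _ = _ := by
        rw [← mul_assoc, ← ENNReal.ofReal_mul (by positivity), mul_assoc _ V⁻¹ V,
          inv_mul_cancel₀ hV0.ne', mul_one]

/-! ### Minkowski, Hölder and mixed norms -/

/-- Minkowski's integral inequality, for a finite outer measure. -/
theorem lintegral_lintegral_rpow_le {α β : Type*} [MeasurableSpace α] [MeasurableSpace β]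
    (μ : Measure α) (ν : Measure β) [IsFiniteMeasure μ] [SFinite ν] {p : ℝ} (hp : 1 < p)
    {g : α × β → ℝ≥0∞} (hg : Measurable g) :
    (∫⁻ x, (∫⁻ y, g (x, y) ∂ν) ^ p ∂μ) ^ (1 / p) ≤
      ∫⁻ y, (∫⁻ x, g (x, y) ^ p ∂μ) ^ (1 / p) ∂ν := by
  set R := ∫⁻ y, (∫⁻ x, g (x, y) ^ p ∂μ) ^ (1 / p) ∂ν with hR
  have hp0 : 0 < p := by linarith
  have hpq : p.HolderConjugate (p.conjExponent) := Real.HolderConjugate.conjExponent hp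
  set p' := p.conjExponent with hp'
  set G : α → ℝ≥0∞ := fun x => ∫⁻ y, g (x, y) ∂ν with hG
  have hGm : Measurable G := hg.lintegral_prod_right'
  have hGn : ∀ n : ℕ, Measurable fun x => min (G x) (n : ℝ≥0∞) := fun n =>
    hGm.min measurable_const
  have hpp' : (p - 1) * p' = p := hpq.sub_one_mul_conj
  -- Truncating at n on a finite measure space makes J finite, so the factor J^(1/p') produced by
  -- Hölder can be cancelled. Monotone convergence removes the truncation.
  have trunc : ∀ n : ℕ, (∫⁻ x, (min (G x) n) ^ p ∂μ) ≤ R ^ p := by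
    intro n
    set J := ∫⁻ x, (min (G x) (n : ℝ≥0∞)) ^ p ∂μ with hJ
    have hJtop : J ≠ ∞ := by
      refine ((lintegral_mono (g := fun _ => (n : ℝ≥0∞) ^ p) fun x =>
        ENNReal.rpow_le_rpow (min_le_right _ _) hp0.le).trans_lt ?_).ne
      rw [lintegral_const]
      exact ENNReal.mul_lt_top (ENNReal.rpow_lt_top_of_nonneg hp0.le (ENNReal.natCast_ne_top n))
        (measure_lt_top _ _)
    have h1 : J ≤ R * J ^ (1 / p') := by
      calc J ≤ ∫⁻ x, ∫⁻ y, g (x, y) * (min (G x) (n : ℝ≥0∞)) ^ (p - 1) ∂ν ∂μ := by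
            refine lintegral_mono fun x => ?_
            rw [lintegral_mul_const (f := fun y => g (x, y)) _ (hg.comp measurable_prodMk_left)]
            calc (min (G x) (n : ℝ≥0∞)) ^ p
                = min (G x) (n : ℝ≥0∞) * min (G x) (n : ℝ≥0∞) ^ (p - 1) := by
                  conv_lhs => rw [show p = 1 + (p - 1) by ring,
                    ENNReal.rpow_add_of_nonneg _ _ zero_le_one (by linarith), ENNReal.rpow_one]
              _ ≤ _ := mul_le_mul_left (min_le_left _ _) _
        _ = ∫⁻ y, ∫⁻ x, g (x, y) * (min (G x) (n : ℝ≥0∞)) ^ (p - 1) ∂μ ∂ν :=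
            lintegral_lintegral_swap
              (hg.mul (((hGn n).comp measurable_fst).pow_const _)).aemeasurable
        _ ≤ ∫⁻ y, (∫⁻ x, g (x, y) ^ p ∂μ) ^ (1 / p) * J ^ (1 / p') ∂ν := by
            refine lintegral_mono fun y => ?_
            refine (ENNReal.lintegral_mul_le_Lp_mul_Lq μ hpq
              (hg.comp measurable_prodMk_right).aemeasurable
              ((hGn n).pow_const (p - 1)).aemeasurable).trans (le_of_eq ?_)
            simp only [← ENNReal.rpow_mul, hpp']
            rfl
        _ = R * J ^ (1 / p') := by
            rw [lintegral_mul_const _ ((hg.pow_const p).lintegral_prod_left'.pow_const _)]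
    by_cases hJ0 : J = 0
    · rw [hJ0]; exact zero_le
    have h2 : J ^ (1 / p) ≤ R := by
      have hJ' : J ^ (1 / p') ≠ 0 := (ENNReal.rpow_pos (pos_iff_ne_zero.2 hJ0) hJtop).ne'
      have hJt : J ^ (1 / p') ≠ ∞ :=
        ENNReal.rpow_ne_top_of_nonneg (one_div_nonneg.2 hpq.symm.nonneg) hJtop
      refine (ENNReal.mul_le_mul_iff_left hJ' hJt).1 ?_
      rw [← ENNReal.rpow_add _ _ hJ0 hJtop]
      have : 1 / p + 1 / p' = 1 := by
        simpa [one_div] using hpq.inv_add_inv_eq_one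
      rwa [this, ENNReal.rpow_one]
    calc J = (J ^ (1 / p)) ^ p := by
          rw [← ENNReal.rpow_mul, one_div, inv_mul_cancel₀ hp0.ne', ENNReal.rpow_one]
      _ ≤ R ^ p := ENNReal.rpow_le_rpow h2 hp0.le
  have hlim : ∫⁻ x, G x ^ p ∂μ ≤ R ^ p := by
    have hsup : ∀ x, G x ^ p = ⨆ n : ℕ, (min (G x) (n : ℝ≥0∞)) ^ p := by
      intro x
      have : G x = ⨆ n : ℕ, min (G x) (n : ℝ≥0∞) := by
        rw [← inf_iSup_eq, ENNReal.iSup_natCast, inf_top_eq]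
      have h2 := (ENNReal.orderIsoRpow p hp0).map_iSup fun n : ℕ => min (G x) (n : ℝ≥0∞)
      simp only [ENNReal.orderIsoRpow_apply] at h2
      rw [← h2, ← this]
    simp_rw [hsup]
    rw [lintegral_iSup (fun n => (hGn n).pow_const _)]
    · exact iSup_le trunc
    · intro m n hmn x
      refine ENNReal.rpow_le_rpow (min_le_min le_rfl ?_) hp0.le
      exact_mod_cast hmn
  calc (∫⁻ x, G x ^ p ∂μ) ^ (1 / p) ≤ (R ^ p) ^ (1 / p) :=
        ENNReal.rpow_le_rpow hlim (by positivity)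
    _ = R := by rw [← ENNReal.rpow_mul, mul_one_div_cancel hp0.ne', ENNReal.rpow_one]

/-- Hölder's inequality with weights. -/
theorem lintegral_rpow_mul_rpow_le {α : Type*} [MeasurableSpace α] (μ : Measure α) {a b : ℝ}
    (ha : 0 < a) (hb : 0 < b) (hab : a + b = 1) {f g : α → ℝ≥0∞}
    (hf : AEMeasurable f μ) (hg : AEMeasurable g μ) :
    ∫⁻ x, f x ^ a * g x ^ b ∂μ ≤ (∫⁻ x, f x ∂μ) ^ a * (∫⁻ x, g x ∂μ) ^ b := by
  have hpq : (1 / a).HolderConjugate (1 / b) := by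
    rw [Real.holderConjugate_iff]
    refine ⟨?_, by simpa using hab⟩
    rw [lt_one_div one_pos ha, one_div_one]; linarith
  refine (ENNReal.lintegral_mul_le_Lp_mul_Lq μ hpq (hf.pow_const a) (hg.pow_const b)).trans
    (le_of_eq ?_)
  simp only [← ENNReal.rpow_mul, mul_one_div_cancel ha.ne', mul_one_div_cancel hb.ne',
    ENNReal.rpow_one, one_div_one_div]

/-- Interpolation between `L²_y L^q_x` and `L²_x L^q_y`. -/
theorem lintegral_mixed_interpolation {α β : Type*} [MeasurableSpace α] [MeasurableSpace β]
    (μ : Measure α) (ν : Measure β) [IsFiniteMeasure μ] [SFinite ν] {p q : ℝ} (hq : 2 < q)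
    (hp : p / 4 + p / (2 * q) = 1) (hp0 : 0 < p) {F G : α × β → ℝ≥0∞}
    (hF : Measurable F) (hG : Measurable G) :
    ∫⁻ z, F z ^ (p / 2) * G z ^ (p / 2) ∂(μ.prod ν) ≤
      (∫⁻ y, (∫⁻ x, F (x, y) ^ q ∂μ) ^ (2 / q) ∂ν) ^ (p / 4) *
        (∫⁻ x, (∫⁻ y, G (x, y) ^ q ∂ν) ^ (2 / q) ∂μ) ^ (p / 4) := by
  have hq0 : 0 < q := by linarith
  have ha : 0 < p / 4 := by positivity
  have hb : 0 < p / (2 * q) := by positivity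
  have hF2 : Measurable fun z => F z ^ (2 : ℝ) := hF.pow_const _
  have hGq : Measurable fun z => G z ^ q := hG.pow_const _
  set Φ : α → ℝ≥0∞ := fun x => ∫⁻ y, F (x, y) ^ (2 : ℝ) ∂ν with hΦ
  have hΦm : Measurable Φ := hF2.lintegral_prod_right'
  set Y : α → ℝ≥0∞ := fun x => (∫⁻ y, G (x, y) ^ q ∂ν) with hY
  have hYm : Measurable Y := hGq.lintegral_prod_right'
  have hmink := lintegral_lintegral_rpow_le μ ν (p := q / 2) (by linarith) hF2
  have e1 : ∀ z : ℝ≥0∞, (z ^ (2 : ℝ)) ^ (q / 2) = z ^ q := fun z => by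
    rw [← ENNReal.rpow_mul]; congr 1; ring
  simp only [e1] at hmink
  rw [show 1 / (q / 2) = 2 / q by field_simp] at hmink
  rw [lintegral_prod _ (by fun_prop)]
  -- Hölder with weights p/4 and p/(2q) is used in y, then in x with the two weights exchanged. This
  -- leaves F in L^q_x L²_y, which Minkowski bounds by L²_y L^q_x since q > 2.
  calc ∫⁻ x, ∫⁻ y, F (x, y) ^ (p / 2) * G (x, y) ^ (p / 2) ∂ν ∂μ
      ≤ ∫⁻ x, (Φ x) ^ (p / 4) * (Y x) ^ (p / (2 * q)) ∂μ := by
        refine lintegral_mono fun x => ?_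
        refine le_trans (le_of_eq ?_) (lintegral_rpow_mul_rpow_le ν ha hb hp
          (hF2.comp measurable_prodMk_left).aemeasurable
          (hGq.comp measurable_prodMk_left).aemeasurable)
        refine lintegral_congr fun y => ?_
        simp only [← ENNReal.rpow_mul]
        congr 2
        · ring
        · field_simp
    _ = ∫⁻ x, ((Y x) ^ (2 / q)) ^ (p / 4) * ((Φ x) ^ (q / 2)) ^ (p / (2 * q)) ∂μ := by
        refine lintegral_congr fun x => ?_
        simp only [← ENNReal.rpow_mul]
        rw [mul_comm]
        congr 2
        · field_simp; norm_num
        · field_simp; norm_num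
    _ ≤ (∫⁻ x, Y x ^ (2 / q) ∂μ) ^ (p / 4) * (∫⁻ x, Φ x ^ (q / 2) ∂μ) ^ (p / (2 * q)) :=
        lintegral_rpow_mul_rpow_le μ ha hb hp (hYm.pow_const _).aemeasurable
          (hΦm.pow_const _).aemeasurable
    _ ≤ _ := by
        rw [mul_comm]
        refine mul_le_mul_left ?_ _
        calc (∫⁻ x, Φ x ^ (q / 2) ∂μ) ^ (p / (2 * q))
            = ((∫⁻ x, Φ x ^ (q / 2) ∂μ) ^ (2 / q)) ^ (p / 4) := by
              rw [← ENNReal.rpow_mul]; congr 1; field_simp; norm_num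
          _ ≤ _ := ENNReal.rpow_le_rpow hmink ha.le

/-! ### Weighted Sobolev bounds and the interpolation exponents -/

theorem bracketPow_mul (a b : ℝ) (v : E3) :
    bracketPow a v * bracketPow b v = bracketPow (a + b) v := by
  unfold bracketPow
  rw [← Real.rpow_add (by positivity)]
  congr 1; ring

theorem enorm_weight (a : ℝ) (h : T3 × E3 → ℂ) (z : T3 × E3) :
    ‖weight a h z‖ₑ = ENNReal.ofReal (bracketPow a z.2) * ‖h z‖ₑ := by
  rw [weight, enorm_mul, ← ofReal_norm, Complex.norm_of_nonneg (bracketPow_pos _ _).le]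

theorem measurable_weight_fst (a : ℝ) :
    Measurable fun z : T3 × E3 => (bracketPow a z.2 : ℂ) :=
  Complex.measurable_ofReal.comp ((measurable_bracketPow a).comp measurable_snd)

theorem aestronglyMeasurable_weight (a : ℝ) {h : T3 × E3 → ℂ}
    (hh : AEStronglyMeasurable h volume) : AEStronglyMeasurable (weight a h) volume :=
  (measurable_weight_fst a).aestronglyMeasurable.mul hh

theorem measurable_weight (a : ℝ) {h : T3 × E3 → ℂ} (hh : Measurable h) :
    Measurable (weight a h) :=
  (measurable_weight_fst a).mul hh

/-- The Sobolev inequality in `x`, with a weight in `v`, integrated over `v`. -/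
theorem exists_weighted_sobolev_torus {r : ℝ} (hr : 0 < r) (hr3 : 2 * r < 3) :
    ∃ C : ℝ, 0 < C ∧ ∀ (a : ℝ) (h g : T3 × E3 → ℂ), AEStronglyMeasurable g volume →
      (∀ᵐ v : E3, IsDxPow r (fun x => h (x, v)) (fun x => g (x, v))) →
      ∫⁻ v : E3, (∫⁻ x : T3, ‖weight a h (x, v)‖ₑ ^ (2 * 3 / (3 - 2 * r))) ^ ((3 - 2 * r) / 3) ≤
        ENNReal.ofReal C * eLpNorm (weight a g) 2 volume ^ 2 := by
  obtain ⟨C, hC, hsob⟩ := exists_sobolev_torus hr hr3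
  have h3r : 0 < 3 - 2 * r := by linarith
  refine ⟨C, hC, fun a h g hg hhg => ?_⟩
  have hint : eLpNorm (weight a g) 2 volume ^ 2 =
      ∫⁻ v : E3, ∫⁻ x : T3, ‖weight a g (x, v)‖ₑ ^ (2 : ℝ) := by
    rw [eLpNorm_two_sq, Measure.volume_eq_prod, lintegral_prod_symm]
    exact ((aestronglyMeasurable_weight a hg).enorm.pow_const _)
  rw [hint, ← lintegral_const_mul' _ _ ENNReal.ofReal_ne_top]
  refine lintegral_mono_ae ?_
  filter_upwards [hhg] with v hv
  -- For fixed v the weight is a finite constant in x, and both sides scale by its square.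
  have hw : ∀ t : ℝ, ENNReal.ofReal (bracketPow a v) ^ t ≠ ∞ := fun t => by
    rw [ENNReal.ofReal_rpow_of_pos (bracketPow_pos a v)]
    exact ENNReal.ofReal_ne_top
  simp only [enorm_weight, ENNReal.mul_rpow_of_nonneg _ _ zero_le_two,
    ENNReal.mul_rpow_of_nonneg _ _ (show 0 ≤ 2 * 3 / (3 - 2 * r) by positivity)]
  rw [lintegral_const_mul' _ _ (hw _), lintegral_const_mul' _ _ (hw _),
    ENNReal.mul_rpow_of_nonneg _ _ (by positivity), ← ENNReal.rpow_mul,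
    show 2 * 3 / (3 - 2 * r) * ((3 - 2 * r) / 3) = 2 by field_simp, mul_left_comm]
  exact mul_le_mul_right (hsob _ _ hv) _

/-- The Sobolev inequality in `v`, integrated over `x`. -/
theorem exists_integrated_sobolev_velocity {r s : ℝ} (hr : 0 < r) (hr3 : 2 * r < 3)
    (hrs : r ≤ s) :
    ∃ C : ℝ, 0 < C ∧ ∀ f g : T3 × E3 → ℂ, AEStronglyMeasurable g volume →
      (∀ᵐ x : T3, IsDvPow s (fun v => f (x, v)) (fun v => g (x, v))) →
      ∫⁻ x : T3, (∫⁻ v : E3, ‖f (x, v)‖ₑ ^ (2 * 3 / (3 - 2 * r))) ^ ((3 - 2 * r) / 3) ≤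
        ENNReal.ofReal C * eLpNorm g 2 volume ^ 2 := by
  obtain ⟨C, hC, hsob⟩ := exists_sobolev_velocity hr hr3 hrs
  refine ⟨C, hC, fun f g hg hfg => ?_⟩
  have hint : eLpNorm g 2 volume ^ 2 = ∫⁻ x : T3, ∫⁻ v : E3, ‖g (x, v)‖ₑ ^ (2 : ℝ) := by
    rw [eLpNorm_two_sq, Measure.volume_eq_prod, lintegral_prod]
    exact hg.enorm.pow_const _
  rw [hint, ← lintegral_const_mul' _ _ ENNReal.ofReal_ne_top]
  refine lintegral_mono_ae ?_
  filter_upwards [hfg] with x hx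
  exact hsob _ _ hx

/-- Interpolation of a weighted `L²` norm between the two mixed norms and a weighted `L¹` norm. -/
theorem eLpNorm_weight_sq_le {s γ : ℝ} (hs : 0 < s) {q : ℝ}
    (hq : q = 2 * 3 / (3 - 2 * (s / (1 + 2 * s)))) {h : T3 × E3 → ℂ} (hh : Measurable h) :
    eLpNorm (weight (s + γ / 2) h) 2 volume ^ 2 ≤
      (∫⁻ v : E3, (∫⁻ x : T3, ‖weight (γ / (2 * (1 + 2 * s))) h (x, v)‖ₑ ^ q) ^ (2 / q)) ^
          ((3 + 6 * s) / (3 + 7 * s) / 2) *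
        (∫⁻ x : T3, (∫⁻ v : E3, ‖weight (γ / 2) h (x, v)‖ₑ ^ q) ^ (2 / q)) ^
          ((3 + 6 * s) / (3 + 7 * s) / 2) *
        (eLpNorm (weight (3 + 7 * s + 2 * γ) h) 1 volume ^ 2) ^ (s / (3 + 7 * s)) := by
  have hq' : q = 6 * (1 + 2 * s) / (3 + 4 * s) := by
    have h1 : 3 - 2 * (s / (1 + 2 * s)) = (3 + 4 * s) / (1 + 2 * s) := by field_simp; ring
    rw [hq, h1]; field_simp; norm_num
  have hq2 : 2 < q := by
    rw [hq', lt_div_iff₀ (by positivity)]; linarith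
  -- Here 1/p = 1/4 + 1/(2q); κ solves pκ + (1-κ) = 2, placing L² between L^p and L¹; and θ = pκ/2
  -- is the power carried by each of the two mixed-norm functions.
  set κ := (3 + 5 * s) / (3 + 7 * s) with hκ
  set p := (6 + 12 * s) / (3 + 5 * s) with hp
  set θ := (3 + 6 * s) / (3 + 7 * s) with hθ
  have hκ0 : 0 < κ := by positivity
  have hp0 : 0 < p := by positivity
  have hθ0 : 0 < θ := by positivity
  have hκ1 : 2 * s / (3 + 7 * s) = 1 - κ := by rw [hκ]; field_simp; ring
  have hκ1' : 0 < 1 - κ := by rw [← hκ1]; positivity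
  have hpκ : p / 2 * κ = θ := by rw [hp, hκ, hθ]; field_simp; ring
  have hpq : p / 4 + p / (2 * q) = 1 := by rw [hp, hq']; field_simp; norm_num; ring
  set F : T3 × E3 → ℝ≥0∞ := fun z => ‖weight (γ / (2 * (1 + 2 * s))) h z‖ₑ with hF
  set G : T3 × E3 → ℝ≥0∞ := fun z => ‖weight (γ / 2) h z‖ₑ with hG
  set L : T3 × E3 → ℝ≥0∞ := fun z => ‖weight (3 + 7 * s + 2 * γ) h z‖ₑ with hL
  have hFm : Measurable F := (measurable_weight _ hh).enorm
  have hGm : Measurable G := (measurable_weight _ hh).enorm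
  have hLm : Measurable L := (measurable_weight _ hh).enorm
  have hpt : ∀ z, ‖weight (s + γ / 2) h z‖ₑ ^ (2 : ℝ) =
      (F z ^ (p / 2) * G z ^ (p / 2)) ^ κ * L z ^ (1 - κ) := by
    intro z
    rw [ENNReal.mul_rpow_of_nonneg _ _ hκ0.le, ← ENNReal.rpow_mul, ← ENNReal.rpow_mul, hpκ]
    simp only [hF, hG, hL, enorm_weight]
    rw [ENNReal.mul_rpow_of_nonneg _ _ zero_le_two, ENNReal.mul_rpow_of_nonneg _ _ hθ0.le,
      ENNReal.mul_rpow_of_nonneg _ _ hθ0.le, ENNReal.mul_rpow_of_nonneg _ _ hκ1'.le]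
    have hH : ‖h z‖ₑ ^ (2 : ℝ) = ‖h z‖ₑ ^ θ * ‖h z‖ₑ ^ θ * ‖h z‖ₑ ^ (1 - κ) := by
      rw [← ENNReal.rpow_add_of_nonneg _ _ hθ0.le hθ0.le,
        ← ENNReal.rpow_add_of_nonneg _ _ (by positivity) hκ1'.le]
      congr 1
      rw [← hκ1, hθ]; field_simp; ring
    -- The weights balance as 2s + γ = θ(γ/(2(1+2s)) + γ/2) + (1-κ)(3+7s+2γ), with 1-κ = 2s/(3+7s);
    -- this dictates the L¹ weight.
    have hw : ENNReal.ofReal (bracketPow (s + γ / 2) z.2) ^ (2 : ℝ) =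
        ENNReal.ofReal (bracketPow (γ / (2 * (1 + 2 * s))) z.2) ^ θ *
          ENNReal.ofReal (bracketPow (γ / 2) z.2) ^ θ *
          ENNReal.ofReal (bracketPow (3 + 7 * s + 2 * γ) z.2) ^ (1 - κ) := by
      rw [ENNReal.ofReal_rpow_of_pos (bracketPow_pos _ _),
        ENNReal.ofReal_rpow_of_pos (bracketPow_pos _ _),
        ENNReal.ofReal_rpow_of_pos (bracketPow_pos _ _),
        ENNReal.ofReal_rpow_of_pos (bracketPow_pos _ _)]
      simp only [bracketPow_rpow]
      rw [← ENNReal.ofReal_mul (bracketPow_pos _ _).le, bracketPow_mul,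
        ← ENNReal.ofReal_mul (bracketPow_pos _ _).le, bracketPow_mul]
      congr 2
      rw [← hκ1, hθ]; field_simp; ring
    rw [hH, hw]
    ring
  have hmix := lintegral_mixed_interpolation (volume : Measure T3) (volume : Measure E3) hq2 hpq hp0
    hFm hGm
  calc eLpNorm (weight (s + γ / 2) h) 2 volume ^ 2
      = ∫⁻ z, (F z ^ (p / 2) * G z ^ (p / 2)) ^ κ * L z ^ (1 - κ) := by
        rw [eLpNorm_two_sq]; exact lintegral_congr hpt
    _ ≤ (∫⁻ z, F z ^ (p / 2) * G z ^ (p / 2)) ^ κ * (∫⁻ z, L z) ^ (1 - κ) :=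
        lintegral_rpow_mul_rpow_le _ hκ0 hκ1' (by ring) (by fun_prop) hLm.aemeasurable
    _ ≤ _ := by
        refine mul_le_mul' ((ENNReal.rpow_le_rpow hmix hκ0.le).trans (le_of_eq ?_)) (le_of_eq ?_)
        · rw [ENNReal.mul_rpow_of_nonneg _ _ hκ0.le, ← ENNReal.rpow_mul, ← ENNReal.rpow_mul,
            show p / 4 * κ = θ / 2 by rw [← hpκ]; ring]
        · rw [eLpNorm_one_eq_lintegral_enorm, ← hκ1, ← ENNReal.rpow_natCast, ← ENNReal.rpow_mul]
          congr 1
          push_cast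
          ring

/-! ### Young's inequality and conclusion -/

/-- The coefficient of M is chosen so that the left side is exactly a^θ b^(1-θ), with a and b the
two terms on the right; both are at most a + b. -/
theorem weighted_young {K ε θ : ℝ} (hK : 0 < K) (hε : 0 < ε) (hθ : 0 < θ) (hθ1 : θ < 1)
    (S M : ℝ≥0∞) :
    (ENNReal.ofReal K * S) ^ θ * M ^ (1 - θ) ≤
      ENNReal.ofReal ε * S + ENNReal.ofReal (K ^ (θ / (1 - θ)) * ε ^ (-(θ / (1 - θ)))) * M := by
  have h1 : 0 < 1 - θ := by linarith
  set a := ENNReal.ofReal ε * S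
  set b := ENNReal.ofReal (K ^ (θ / (1 - θ)) * ε ^ (-(θ / (1 - θ)))) * M
  have e : (ENNReal.ofReal K * S) ^ θ * M ^ (1 - θ) = a ^ θ * b ^ (1 - θ) := by
    simp only [a, b]
    rw [ENNReal.mul_rpow_of_nonneg _ _ hθ.le, ENNReal.mul_rpow_of_nonneg _ _ hθ.le,
      ENNReal.mul_rpow_of_nonneg _ _ h1.le, ENNReal.ofReal_rpow_of_pos hK,
      ENNReal.ofReal_rpow_of_pos hε, ENNReal.ofReal_rpow_of_pos (by positivity)]
    have : K ^ θ = ε ^ θ * (K ^ (θ / (1 - θ)) * ε ^ (-(θ / (1 - θ)))) ^ (1 - θ) := by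
      rw [Real.mul_rpow (by positivity) (by positivity), ← Real.rpow_mul hK.le,
        ← Real.rpow_mul hε.le, div_mul_cancel₀ _ h1.ne', neg_mul, div_mul_cancel₀ _ h1.ne',
        mul_left_comm, ← Real.rpow_add hε]
      simp
    rw [this, ENNReal.ofReal_mul (by positivity)]
    ring
  rw [e]
  calc a ^ θ * b ^ (1 - θ) ≤ (a + b) ^ θ * (a + b) ^ (1 - θ) := by
        gcongr
        · exact le_self_add
        · exact le_add_self
    _ = a + b := by
        rw [← ENNReal.rpow_add_of_nonneg _ _ hθ.le h1.le, add_sub_cancel, ENNReal.rpow_one]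

/-- The estimate for given representatives of `⟨D_x⟩^r h` and `⟨D_v⟩^s ⟨v⟩^{γ/2} h`. -/
theorem exists_interpolation_estimate {s : ℝ} (hs : 0 < s) :
    ∃ C : ℝ, 0 < C ∧ ∀ (γ ε : ℝ), 0 < ε → ∀ h g₁ g₂ : T3 × E3 → ℂ,
      AEStronglyMeasurable h volume → AEStronglyMeasurable g₁ volume →
      AEStronglyMeasurable g₂ volume →
      (∀ᵐ v : E3, IsDxPow (s / (1 + 2 * s)) (fun x => h (x, v)) (fun x => g₁ (x, v))) →
      (∀ᵐ x : T3, IsDvPow s (fun v => weight (γ / 2) h (x, v)) (fun v => g₂ (x, v))) →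
      eLpNorm (weight (s + γ / 2) h) 2 volume ^ 2 ≤
        ENNReal.ofReal ε * (eLpNorm (weight (γ / (2 * (1 + 2 * s))) g₁) 2 volume ^ 2 +
          eLpNorm g₂ 2 volume ^ 2) +
        ENNReal.ofReal (C * ε ^ (-((3 + 6 * s) / s))) *
          eLpNorm (weight (3 + 7 * s + 2 * γ) h) 1 volume ^ 2 := by
  set r := s / (1 + 2 * s) with hr
  have hr0 : 0 < r := by positivity
  have hr3 : 2 * r < 3 := by
    rw [hr, ← mul_div_assoc, div_lt_iff₀ (by positivity)]; linarith
  have hrs : r ≤ s := div_le_self hs.le (by linarith)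
  have h3r : 0 < 3 - 2 * r := by linarith
  obtain ⟨C₁, hC₁, hx⟩ := exists_weighted_sobolev_torus hr0 hr3
  obtain ⟨C₂, hC₂, hv⟩ := exists_integrated_sobolev_velocity hr0 hr3 hrs
  set θ := (3 + 6 * s) / (3 + 7 * s) with hθ
  have hθ0 : 0 < θ := by positivity
  have hθ1' : 1 - θ = s / (3 + 7 * s) := by rw [hθ]; field_simp; ring
  have hθ1 : θ < 1 := by
    have : 0 < 1 - θ := by rw [hθ1']; positivity
    linarith
  have hθ2 : θ / (1 - θ) = (3 + 6 * s) / s := by rw [hθ1', hθ]; field_simp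
  refine ⟨(C₁ + C₂) ^ ((3 + 6 * s) / s), by positivity,
    fun γ ε hε h g₁ g₂ hh hg₁ hg₂ hhg₁ hhg₂ => ?_⟩
  -- The mixed-norm interpolation needs a genuinely measurable function. By Fubini, replacing h by k
  -- changes almost every slice only on a null set, so both mixed norms are unchanged.
  set k := hh.aemeasurable.mk h with hk
  have hkm : Measurable k := hh.aemeasurable.measurable_mk
  have hhk : h =ᵐ[volume] k := hh.aemeasurable.ae_eq_mk
  have hwk : ∀ a, weight a h =ᵐ[volume] weight a k := fun a => by
    filter_upwards [hhk] with z hz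
    simp only [weight, hz]
  have hxk : ∀ᵐ x : T3, ∀ᵐ v : E3, h (x, v) = k (x, v) :=
    Measure.ae_ae_of_ae_prod (μ := (volume : Measure T3)) (ν := (volume : Measure E3)) hhk
  have hvk : ∀ᵐ v : E3, ∀ᵐ x : T3, h (x, v) = k (x, v) := by
    have hswap : ∀ᵐ z ∂((volume : Measure E3).prod (volume : Measure T3)), h z.swap = k z.swap :=
      Measure.measurePreserving_swap.quasiMeasurePreserving.ae hhk
    exact Measure.ae_ae_of_ae_prod hswap
  have hX := hx (γ / (2 * (1 + 2 * s))) h g₁ hg₁ hhg₁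
  have hV := hv (weight (γ / 2) h) g₂ hg₂ hhg₂
  have hXk : ∫⁻ v : E3, (∫⁻ x : T3, ‖weight (γ / (2 * (1 + 2 * s))) h (x, v)‖ₑ ^
      (2 * 3 / (3 - 2 * r))) ^ ((3 - 2 * r) / 3) =
      ∫⁻ v : E3, (∫⁻ x : T3, ‖weight (γ / (2 * (1 + 2 * s))) k (x, v)‖ₑ ^
        (2 * 3 / (3 - 2 * r))) ^ ((3 - 2 * r) / 3) := by
    refine lintegral_congr_ae ?_
    filter_upwards [hvk] with v hv
    congr 1
    refine lintegral_congr_ae ?_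
    filter_upwards [hv] with x hx
    simp only [weight, hx]
  have hVk : ∫⁻ x : T3, (∫⁻ v : E3, ‖weight (γ / 2) h (x, v)‖ₑ ^
      (2 * 3 / (3 - 2 * r))) ^ ((3 - 2 * r) / 3) =
      ∫⁻ x : T3, (∫⁻ v : E3, ‖weight (γ / 2) k (x, v)‖ₑ ^
        (2 * 3 / (3 - 2 * r))) ^ ((3 - 2 * r) / 3) := by
    refine lintegral_congr_ae ?_
    filter_upwards [hxk] with x hx
    congr 1
    refine lintegral_congr_ae ?_
    filter_upwards [hx] with v hv
    simp only [weight, hv]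
  have hint := eLpNorm_weight_sq_le (γ := γ) hs rfl hkm
  rw [← hr, show 2 / (2 * 3 / (3 - 2 * r)) = (3 - 2 * r) / 3 by field_simp, ← hXk, ← hVk,
    ← eLpNorm_congr_ae (hwk _), ← eLpNorm_congr_ae (hwk _), ← hθ, ← hθ1'] at hint
  set A := eLpNorm (weight (γ / (2 * (1 + 2 * s))) g₁) 2 volume ^ 2
  set B := eLpNorm g₂ 2 volume ^ 2
  set M := eLpNorm (weight (3 + 7 * s + 2 * γ) h) 1 volume ^ 2
  have hK : 0 < C₁ + C₂ := by positivity
  have hA : ENNReal.ofReal C₁ * A ≤ ENNReal.ofReal (C₁ + C₂) * (A + B) :=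
    mul_le_mul' (ENNReal.ofReal_le_ofReal (by linarith)) le_self_add
  have hB : ENNReal.ofReal C₂ * B ≤ ENNReal.ofReal (C₁ + C₂) * (A + B) :=
    mul_le_mul' (ENNReal.ofReal_le_ofReal (by linarith)) le_add_self
  have hyoung := weighted_young hK hε hθ0 hθ1 (A + B) M
  rw [hθ2] at hyoung
  refine (hint.trans ?_).trans hyoung
  refine mul_le_mul_left ?_ _
  calc _ ≤ (ENNReal.ofReal (C₁ + C₂) * (A + B)) ^ (θ / 2) *
        (ENNReal.ofReal (C₁ + C₂) * (A + B)) ^ (θ / 2) :=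
        mul_le_mul' (ENNReal.rpow_le_rpow (hX.trans hA) (by positivity))
          (ENNReal.rpow_le_rpow (hV.trans hB) (by positivity))
    _ = _ := by
        rw [← ENNReal.rpow_add_of_nonneg _ _ (by positivity) (by positivity), add_halves]

/-- Serves to pass to norms defined as infima over representatives: near-minimisers suffice, by
continuity as δ tends to 0. -/
theorem le_of_forall_pos_add_le {W x y R : ℝ≥0∞} {ε : ℝ}
    (h : ∀ δ : ℝ≥0∞, 0 < δ → W ≤ ENNReal.ofReal ε * ((x + δ) ^ 2 + (y + δ) ^ 2) + R) :
    W ≤ ENNReal.ofReal ε * (x ^ 2 + y ^ 2) + R := by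
  have hc : Continuous fun δ : ℝ≥0∞ =>
      ENNReal.ofReal ε * ((x + δ) ^ 2 + (y + δ) ^ 2) + R := by
    refine ((ENNReal.continuous_const_mul ENNReal.ofReal_ne_top).comp ?_).add continuous_const
    exact ((ENNReal.continuous_pow 2).comp (continuous_const.add continuous_id)).add
      ((ENNReal.continuous_pow 2).comp (continuous_const.add continuous_id))
  have ht := (hc.tendsto 0).mono_left (nhdsWithin_le_nhds (s := Ioi 0))
  simp only [add_zero] at ht
  exact ge_of_tendsto ht (by filter_upwards [self_mem_nhdsWithin] with δ hδ using h δ hδ)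

end KineticLemma

end

theorem mainTheorem5 (s γ : ℝ) (hs0 : 0 < s) (hs1 : s < 1) (hγ : 0 ≤ γ) :
    ∃ C : ℝ, 0 < C ∧ ∀ ε : ℝ, 0 < ε →
      ∀ h : KineticLemma.T3 × KineticLemma.E3 → ℂ, AEStronglyMeasurable h volume →
        eLpNorm (KineticLemma.weight (s + γ / 2) h) 2 volume ^ 2 ≤
          ENNReal.ofReal ε *
              (KineticLemma.normDx (γ / (2 * (1 + 2 * s))) (s / (1 + 2 * s)) h ^ 2 +
                KineticLemma.tripleNormSq s γ h) +
            ENNReal.ofReal (C * ε ^ (-((3 + 6 * s) / s))) *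
              eLpNorm (KineticLemma.weight (3 + 7 * s + 2 * γ) h) 1 volume ^ 2 := by
  obtain ⟨C, hC, hest⟩ := KineticLemma.exists_interpolation_estimate hs0
  refine ⟨C, hC, fun ε hε h hh => ?_⟩
  set x := KineticLemma.normDx (γ / (2 * (1 + 2 * s))) (s / (1 + 2 * s)) h with hx
  set y := KineticLemma.normDv s (KineticLemma.weight (γ / 2) h) with hy
  have key : eLpNorm (KineticLemma.weight (s + γ / 2) h) 2 volume ^ 2 ≤
      ENNReal.ofReal ε * (x ^ 2 + y ^ 2) + ENNReal.ofReal (C * ε ^ (-((3 + 6 * s) / s))) *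
        eLpNorm (KineticLemma.weight (3 + 7 * s + 2 * γ) h) 1 volume ^ 2 := by
    -- Needed because 0 · ∞ = 0 in `ℝ≥0∞`: with ε nonzero, an infinite norm makes the right side
    -- infinite.
    have hε' : ENNReal.ofReal ε ≠ 0 := (ENNReal.ofReal_pos.2 hε).ne'
    by_cases hxt : x = ∞
    · simp [hxt, ENNReal.mul_top hε']
    by_cases hyt : y = ∞
    · simp [hyt, ENNReal.mul_top hε']
    refine KineticLemma.le_of_forall_pos_add_le fun δ hδ => ?_
    have hxδ : x < x + δ := ENNReal.lt_add_right hxt hδ.ne'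
    have hyδ : y < y + δ := ENNReal.lt_add_right hyt hδ.ne'
    simp only [hx, KineticLemma.normDx, iInf_lt_iff] at hxδ
    simp only [hy, KineticLemma.normDv, iInf_lt_iff] at hyδ
    obtain ⟨g₁, hg₁, hhg₁, h1⟩ := hxδ
    obtain ⟨g₂, hg₂, hhg₂, h2⟩ := hyδ
    refine (hest γ ε hε h g₁ g₂ hh hg₁ hg₂ hhg₁ hhg₂).trans ?_
    gcongr
    · exact h1.le
    · exact h2.le
  refine key.trans ?_
  -- Only here does the spherical term enter, as a nonnegative addition to the right side.
  unfold KineticLemma.tripleNormSq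
  gcongr
  exact le_self_add
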